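/- Let $k\ge 2$ and $m\ge 1$ be integers and write $[m]=\{1,\dots,m\}$. Let $\mathcal P_k(m)$ be the set of all ordered $k$-tuples $\mathcal S=(S_1,\dots,S_k)$ of pairwise disjoint (possibly empty) subsets of $[m]$ with $S_1\cup\cdots\cup S_k=[m]$. For a $km\times km$ matrix $M$, let $M(\mathcal S)$ denote the principal submatrix of $M$ with rows and columns indexed by $S_1\cup(m+S_2)\cup\cdots\cup((k-1)m+S_k)$. For $A\in\mathbb C^{km\times km}$ the $(k,m)$-characteristic polynomial of $A$ is $$\psi_{k,m}[A](x)=\frac1{k^m}\sum_{\mathcal S\in\mathcal P_k(m)}\det\big[(x\,I_{km}-A)(\mathcal S)\big].$$ Let $A\in\mathbb C^{km\times km}$ be a Hermitian matrix with $0\preceq A\preceq I_{km}$, and set $$\varepsilon=\max_{1\le i\le m}\ \sum_{j=1}^{k}A\big(i+(j-1)m,\;i+(j-1)m\big).$$ If $\varepsilon\le \frac{(k-1)^2}{k}$, then $\psi_{k,m}[A]$ is a nonzero polynomial all of whose coefficients and roots are real, it has a largest root, and this largest root satisfies $$\operatorname{maxroot}\,\psi_{k,m}[A]\ \le\ \frac1k\left(\sqrt{1-\frac{\varepsilon}{k-1}}+\sqrt{\varepsilon}\right)^2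 .$$ -/

import Mathlib

open scoped BigOperators Polynomial ComplexOrder

namespace KMChar

/-- The set `𝒫_k(m)` of `k`-partitions of `[m]`: ordered `k`-tuples of pairwise disjoint
(possibly empty) subsets of `[m]` whose union is `[m]`. -/
def kPartitions (k m : ℕ) : Finset (Fin k → Finset (Fin m)) :=
  Finset.univ.filter fun S =>
    (∀ a b : Fin k, a ≠ b → Disjoint (S a) (S b)) ∧ Finset.univ.biUnion S = Finset.univ

/-- The position `j * m + i` of `[km]`, that is, the `i`-th position in the `j`-th block of
length `m` (everything counted from zero). -/
def pos {k m : ℕ} (j : Fin k) (i : Fin m) : Fin (k * m) :=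
  finProdFinEquiv (j, i)

/-- The value of `pos`, in agreement with its description. -/
theorem pos_val {k m : ℕ} (j : Fin k) (i : Fin m) : (pos j i : ℕ) = i + j * m := by
  simp [pos, finProdFinEquiv, mul_comm]

/-- The index set `S_1 ∪ (m + S_2) ∪ ⋯ ∪ ((k-1)m + S_k)`. -/
def blockUnion {k m : ℕ} (S : Fin k → Finset (Fin m)) : Finset (Fin (k * m)) :=
  Finset.univ.biUnion fun j => (S j).image (pos j)

/-- The principal submatrix `A(S)` with rows and columns indexed by a set `T`. -/
def principal {R : Type*} {n : ℕ} (A : Matrix (Fin n) (Fin n) R) (T : Finset (Fin n)) :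
    Matrix T T R :=
  A.submatrix (fun t => (t : Fin n)) (fun t => (t : Fin n))

/-- The `(k,m)`-determinant `D_{k,m}[A]`, for matrices over a commutative ring. -/
def kmDet {R : Type*} [CommRing R] (k m : ℕ) (A : Matrix (Fin (k * m)) (Fin (k * m)) R) : R :=
  ∑ S ∈ kPartitions k m, (principal A (blockUnion S)).det

/-- The `(k,m)`-characteristic polynomial `ψ_{k,m}[A](x) = k^{-m} D_{k,m}[x I - A]`. -/
noncomputable def kmCharpoly (k m : ℕ) (A : Matrix (Fin (k * m)) (Fin (k * m)) ℂ) : ℂ[X] :=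
  Polynomial.C (1 / (k : ℂ) ^ m) *
    kmDet k m ((Polynomial.X : ℂ[X]) • (1 : Matrix (Fin (k * m)) (Fin (k * m)) ℂ[X]) -
      A.map Polynomial.C)

/-- All coefficients and all roots of `p` are real, and `p` is not the zero polynomial. -/
def RealRooted (p : ℂ[X]) : Prop :=
  p ≠ 0 ∧ (∀ n : ℕ, (p.coeff n).im = 0) ∧ ∀ z : ℂ, p.IsRoot z → z.im = 0

/-- The set of real roots of `p`. -/
def realRoots (p : ℂ[X]) : Set ℝ :=
  {x : ℝ | p.IsRoot (x : ℂ)}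

/-- The largest real root of `p` (meaningful for nonzero `p` with at least one real root). -/
noncomputable def maxroot (p : ℂ[X]) : ℝ :=
  sSup (realRoots p)

end KMChar

/-!
The matrix `A` enters through the polynomial `q(y) = det (Y - A)`, where `Y` is diagonal with the
entry `y i` at the `k` positions of the block `i`. Up to a constant, the polynomial in question is
the diagonal restriction of `∏ i, ∂ᵢ ^ (k - 1) q`; a block is *processed* when its
`∂ᵢ ^ (k - 1)` is applied.

As a function of `y i`, the polynomial `q` is `c ∏ (x - ρ)` with `k` roots `ρ`, and its derivative
of order `k - 1` is a multiple of `c ∑ (x - ρ)`. Two things have to be followed while the blocks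
are processed one by one.

*Real roots.* None of the functions vanishes when all variables lie in the open upper half plane
(`SliceFamily.stable`), because the mean of roots in the closed lower half plane lies there too.
To have nonvanishing leading coefficients `c`, the functions with some blocks deleted are followed
as well. All of them are sums of principal minors of `Y - A` that keep `n i ∈ {0, 1, k}` indices
of the block `i` (`minorSum`).

*The largest root.* Fix `t > 1` and `φ = k / t + ε / (t (t - 1))`. At `y = (t, …, t)` and above,
`q` is positive and its logarithmic derivatives are at most `φ`, by the estimate
`norm_apply_sq_le` for the diagonal of `(t - A)⁻¹`. Since `A ≥ 0`, moreover, the roots are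
nonnegative. Hence among the gaps `t - ρ` even the largest has `1 / (t - ρ) ≥ 1 / t`, the others
have inverses summing to at most `φ - 1 / t`, and so the mean root lies below `t` by much
(`gap_le_sum_sub_roots`). After processing a block, its variable can therefore be lowered to
`t - δ` with `k δ = (k - 1) ^ 2 / (φ - 1 / t)`. This does not increase the logarithmic derivatives
in the other blocks: as a function of the processed variable such a derivative maps the upper half
plane to the closed lower one, hence is a constant plus nonnegative multiples of the functions
`1 / (x - ρ)` (`exists_partial_fractions`). The same expansion shows that the roots remain
nonnegative. When all blocks are processed, every root is below `t - δ`, and the minimum of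
`t - δ` over `t > 1` is the asserted bound (`le_of_forall_barrier`).
-/

namespace KMChar
open Polynomial ComplexConjugate Function

/-! ### Partial fractions of real rational functions preserving a half plane -/

theorem aeval_ofReal_complex (p : ℝ[X]) (x : ℝ) : aeval (x : ℂ) p = ((p.eval x : ℝ) : ℂ) := by
  simpa using (Polynomial.aeval_algebraMap_apply ℂ x p)

theorem aeval_conj_complex (p : ℝ[X]) (z : ℂ) : aeval (conj z) p = conj (aeval z p) := by
  simpa using (Polynomial.aeval_algHom_apply (Complex.conjAe : ℂ →ₐ[ℝ] ℂ) z p)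

theorem exists_real_polynomial (r : ℂ[X]) (h : ∀ x : ℝ, (r.eval (x : ℂ)).im = 0) :
    ∃ R : ℝ[X], R.map (algebraMap ℝ ℂ) = r := by
  have key : r.map (starRingEnd ℂ) = r := by
    apply Polynomial.eq_of_infinite_eval_eq
    apply Set.Infinite.mono (s := Set.range (fun x : ℝ => (x : ℂ)))
    · rintro _ ⟨x, rfl⟩
      have := Polynomial.eval_map_apply (p := r) (f := starRingEnd ℂ) (x : ℂ)
      simp only [Complex.conj_ofReal] at this
      simp only [Set.mem_ofPred_eq, this]
      exact Complex.conj_eq_iff_im.2 (h x)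
    · exact Set.infinite_range_of_injective Complex.ofReal_injective
  have : r ∈ Polynomial.lifts (algebraMap ℝ ℂ) := by
    rw [Polynomial.lifts_iff_coeff_lifts]
    intro n
    refine ⟨(r.coeff n).re, ?_⟩
    have : conj (r.coeff n) = r.coeff n := by
      conv_rhs => rw [← key]
      simp
    simpa using (Complex.conj_eq_iff_re.1 this)
  exact this

/-- The leading behaviour of `u / v` at a root `ρ` of `v = (X - ρ) ^ p * w`, read off along the ray
from `ρ` in the direction `ζ`. -/
theorem im_pow_mul_nonneg_of_herglotz {u w : ℝ[X]} {ρ : ℝ} {p : ℕ}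
    (h : ∀ z : ℂ, 0 < z.im →
      (aeval z u * conj (aeval z ((X - C ρ) ^ p * w))).im ≤ 0) (ζ : ℂ) (hζ : 0 < ζ.im) :
    0 ≤ u.eval ρ * w.eval ρ * (ζ ^ p).im := by
  set g : ℝ → ℝ := fun η => (aeval (ρ + η * ζ : ℂ) u * conj (aeval (ρ + η * ζ : ℂ) w * ζ ^ p)).im
  have hg : Continuous g := by
    have h1 : ∀ p : ℝ[X], Continuous fun η : ℝ => aeval (ρ + η * ζ : ℂ) p := fun p =>
      p.continuous_aeval.comp (by fun_prop)
    apply Complex.continuous_im.comp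
    apply Continuous.mul (h1 u)
    exact Complex.continuous_conj.comp ((h1 w).mul continuous_const)
  have hneg : ∀ η : ℝ, 0 < η → g η ≤ 0 := by
    intro η hη
    have := h (ρ + η * ζ) (by simp; positivity)
    have e : aeval (ρ + η * ζ : ℂ) ((X - C ρ) ^ p * w)
        = ((η ^ p : ℝ) : ℂ) * (aeval (ρ + η * ζ : ℂ) w * ζ ^ p) := by
      simp
      ring
    rw [e, map_mul, Complex.conj_ofReal, mul_left_comm, Complex.im_ofReal_mul] at this
    exact nonpos_of_mul_nonpos_right this (by positivity)
  have h0 : g 0 ≤ 0 := by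
    have hc : Filter.Tendsto g (nhdsWithin 0 (Set.Ioi 0)) (nhds (g 0)) :=
      (hg.tendsto 0).mono_left nhdsWithin_le_nhds
    exact le_of_tendsto hc (Filter.eventually_of_mem self_mem_nhdsWithin hneg)
  have e0 : g 0 = -(u.eval ρ * w.eval ρ * (ζ ^ p).im) := by
    simp only [g, Complex.ofReal_zero, zero_mul, add_zero, aeval_ofReal_complex, map_mul,
      Complex.conj_ofReal]
    rw [← mul_assoc, ← Complex.ofReal_mul, Complex.im_ofReal_mul, Complex.conj_im]
    ring
  linarith

/-- A real rational function `u / v` with nonpositive imaginary part on the upper half plane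
has only simple poles, with nonnegative residues. -/
theorem herglotz_pole {u w : ℝ[X]} {ρ : ℝ} {p : ℕ} (hp : p ≠ 0)
    (hu : u.eval ρ ≠ 0) (hw : w.eval ρ ≠ 0)
    (h : ∀ z : ℂ, 0 < z.im →
      (aeval z u * conj (aeval z ((X - C ρ) ^ p * w))).im ≤ 0) :
    p = 1 ∧ 0 ≤ u.eval ρ * w.eval ρ := by
  have key := im_pow_mul_nonneg_of_herglotz h
  have hp0 : (0 : ℝ) < p := by positivity
  have hpow : ∀ θ : ℝ, (Complex.exp ((θ / p : ℝ) * Complex.I)) ^ p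
      = Complex.exp (θ * Complex.I) := by
    intro θ
    rw [← Complex.exp_nat_mul]
    congr 1
    push_cast
    field_simp
  have him : ∀ θ : ℝ, 0 < θ → θ < p * Real.pi →
      0 ≤ u.eval ρ * w.eval ρ * Real.sin θ := by
    intro θ h1 h2
    have := key (Complex.exp ((θ / p : ℝ) * Complex.I)) (by
      rw [Complex.exp_ofReal_mul_I_im]
      apply Real.sin_pos_of_pos_of_lt_pi
      · positivity
      · rw [div_lt_iff₀ hp0]; linarith)
    rwa [hpow, Complex.exp_ofReal_mul_I_im] at this
  have hpi := Real.pi_pos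
  have hp1 : (1 : ℝ) ≤ p := by exact_mod_cast Nat.one_le_iff_ne_zero.2 hp
  have h1 := him (Real.pi / 2) (by positivity) (by nlinarith)
  rw [Real.sin_pi_div_two, mul_one] at h1
  refine ⟨?_, h1⟩
  by_contra hne
  have hp2 : (2 : ℝ) ≤ p := by
    have : 2 ≤ p := by omega
    exact_mod_cast this
  -- for a pole of order at least two the angle `3π / (2p)` lies in the upper half plane as well
  have h2 := him (Real.pi / 2 + Real.pi) (by positivity) (by nlinarith)
  rw [Real.sin_add_pi, Real.sin_pi_div_two] at h2
  exact mul_ne_zero hu hw (by linarith)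

theorem partial_fractions_of_no_common_root {u v : ℝ[X]} (hv0 : v ≠ 0) (hv : v.Splits)
    (hdeg : u.natDegree ≤ v.natDegree) (hroot : ∀ ρ, v.IsRoot ρ → u.eval ρ ≠ 0)
    (h : ∀ z : ℂ, 0 < z.im → (aeval z u * conj (aeval z v)).im ≤ 0) :
    ∃ (c₀ : ℝ) (S : Finset ℝ) (c : ℝ → ℝ) (q : ℝ → ℝ[X]),
      (∀ ρ ∈ S, 0 ≤ c ρ ∧ v = (X - C ρ) * q ρ) ∧
      u = C c₀ * v + ∑ ρ ∈ S, C (c ρ) * q ρ := by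
  have hsimple : ∀ ρ, v.IsRoot ρ → ∃ q : ℝ[X], v = (X - C ρ) * q ∧ q.eval ρ ≠ 0 ∧
      0 ≤ u.eval ρ * q.eval ρ ∧ v.rootMultiplicity ρ = 1 := by
    intro ρ hρ
    obtain ⟨q, hq, hnd⟩ := Polynomial.exists_eq_pow_rootMultiplicity_mul_and_not_dvd v hv0 ρ
    have hqρ : q.eval ρ ≠ 0 := fun h0 => hnd (dvd_iff_isRoot.2 h0)
    have hm : v.rootMultiplicity ρ ≠ 0 := by
      exact (rootMultiplicity_pos hv0).2 hρ |>.ne'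
    rw [hq] at h
    obtain ⟨h1, h2⟩ := herglotz_pole hm (hroot ρ hρ) hqρ h
    rw [h1, pow_one] at hq
    exact ⟨q, hq, hqρ, h2, h1⟩
  choose! q hq1 hq2 hq3 hq4 using hsimple
  set S := v.roots.toFinset
  have hS : ∀ ρ ∈ S, v.IsRoot ρ := fun ρ hρ => by
    simpa [S, hv0] using hρ
  have hnodup : v.roots.Nodup := by
    rw [Multiset.nodup_iff_count_le_one]
    intro ρ
    rw [count_roots]
    by_cases hρ : v.IsRoot ρ
    · exact (hq4 ρ hρ).le
    · rw [rootMultiplicity_eq_zero hρ]; exact zero_le_one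
  have hcard : S.card = v.natDegree := by
    rw [Multiset.toFinset_card_of_nodup hnodup, hv.natDegree_eq_card_roots]
  have hqdeg : ∀ ρ ∈ S, (q ρ).natDegree + 1 = v.natDegree := by
    intro ρ hρ
    have hq0 : q ρ ≠ 0 := fun h0 => hq2 ρ (hS ρ hρ) (by simp [h0])
    conv_rhs => rw [hq1 ρ (hS ρ hρ)]
    rw [natDegree_mul (X_sub_C_ne_zero ρ) hq0, natDegree_X_sub_C, add_comm]
  refine ⟨u.coeff v.natDegree / v.leadingCoeff, S, fun ρ => u.eval ρ / (q ρ).eval ρ, q, ?_, ?_⟩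
  · intro ρ hρ
    refine ⟨?_, hq1 ρ (hS ρ hρ)⟩
    have := hq3 ρ (hS ρ hρ)
    have h2 := hq2 ρ (hS ρ hρ)
    change 0 ≤ u.eval ρ / (q ρ).eval ρ
    rw [show u.eval ρ / (q ρ).eval ρ = u.eval ρ * (q ρ).eval ρ / ((q ρ).eval ρ) ^ 2 by
      field_simp]
    positivity
  · rw [← sub_eq_zero]
    apply Polynomial.eq_zero_of_degree_lt_of_eval_finset_eq_zero S
    · rw [hcard, Polynomial.degree_lt_iff_coeff_zero]
      intro N hN
      have hqN : ∀ ρ ∈ S, (q ρ).coeff N = 0 := fun ρ hρ =>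
        coeff_eq_zero_of_natDegree_lt (by have := hqdeg ρ hρ; omega)
      rw [coeff_sub, coeff_add, coeff_C_mul, finsetSum_coeff,
        Finset.sum_eq_zero (fun ρ hρ => by rw [coeff_C_mul, hqN ρ hρ, mul_zero]), add_zero]
      rcases hN.eq_or_lt with rfl | hlt
      · have : v.leadingCoeff ≠ 0 := leadingCoeff_ne_zero.2 hv0
        rw [coeff_natDegree]
        field_simp
        simp
      · rw [coeff_eq_zero_of_natDegree_lt (hdeg.trans_lt hlt),
          coeff_eq_zero_of_natDegree_lt hlt]
        simp
    · intro σ hσ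
      have hσ0 : v.eval σ = 0 := hS σ hσ
      rw [eval_sub, eval_add, eval_mul, hσ0, mul_zero, zero_add, eval_finsetSum,
        Finset.sum_eq_single σ]
      · simp only [eval_mul, eval_C]
        rw [div_mul_cancel₀ _ (hq2 σ (hS σ hσ)), sub_self]
      · intro ρ hρ hne
        have : (σ - ρ) * (q ρ).eval σ = 0 := by
          have h1 := congrArg (Polynomial.eval σ) (hq1 ρ (hS ρ hρ))
          rw [hσ0] at h1
          simpa using h1.symm
        rcases mul_eq_zero.1 this with h1 | h1
        · exact absurd (sub_eq_zero.1 h1).symm hne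
        · simp [h1]
      · intro h1; exact absurd hσ h1

/-- Partial fractions of a real rational function `u / v` of degree at most zero with nonpositive
imaginary part on the upper half plane: it is a constant plus a combination with nonnegative
coefficients of the functions `1 / (x - ρ)`, `ρ` a root of `v`. Here `q ρ` stands for
`v / (X - ρ)`, so that common roots of `u` and `v` need no separate treatment. -/
theorem exists_partial_fractions {u v : ℝ[X]} (hv0 : v ≠ 0) (hv : v.Splits)
    (hdeg : u.natDegree ≤ v.natDegree)
    (h : ∀ z : ℂ, 0 < z.im → (aeval z u * conj (aeval z v)).im ≤ 0) :
    ∃ (c₀ : ℝ) (S : Finset ℝ) (c : ℝ → ℝ) (q : ℝ → ℝ[X]),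
      (∀ ρ ∈ S, 0 ≤ c ρ ∧ v = (X - C ρ) * q ρ) ∧
      u = C c₀ * v + ∑ ρ ∈ S, C (c ρ) * q ρ := by
  obtain ⟨n, hn⟩ : ∃ n, v.natDegree = n := ⟨_, rfl⟩
  induction n generalizing u v with
  | zero =>
    apply partial_fractions_of_no_common_root hv0 hv hdeg _ h
    intro ρ hρ
    rw [eq_C_of_natDegree_eq_zero hn] at hρ hv0
    simp only [IsRoot, eval_C] at hρ
    rw [hρ] at hv0
    simp at hv0
  | succ n ih =>
    by_cases hroot : ∀ ρ, v.IsRoot ρ → u.eval ρ ≠ 0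
    · exact partial_fractions_of_no_common_root hv0 hv hdeg hroot h
    push Not at hroot
    obtain ⟨ρ, hρv, hρu⟩ := hroot
    obtain ⟨v₁, rfl⟩ := dvd_iff_isRoot.2 hρv
    obtain ⟨u₁, rfl⟩ := dvd_iff_isRoot.2 hρu
    have hv1 : v₁ ≠ 0 := right_ne_zero_of_mul hv0
    have hd : v₁.natDegree = n := by
      rw [natDegree_mul (X_sub_C_ne_zero ρ) hv1, natDegree_X_sub_C] at hn
      omega
    have hs : v₁.Splits := hv.of_dvd hv0 (dvd_mul_left _ _)
    have hud : u₁.natDegree ≤ v₁.natDegree := by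
      by_cases hu1 : u₁ = 0
      · simp [hu1]
      · rw [natDegree_mul (X_sub_C_ne_zero ρ) hv1,
          natDegree_mul (X_sub_C_ne_zero ρ) hu1] at hdeg
        omega
    have h1 : ∀ z : ℂ, 0 < z.im → (aeval z u₁ * conj (aeval z v₁)).im ≤ 0 := by
      intro z hz
      have hz0 : z - ρ ≠ 0 := fun h0 => by
        have := congrArg Complex.im h0
        simp at this
        exact hz.ne' this
      have := h z hz
      have e : aeval z ((X - C ρ) * u₁) * conj (aeval z ((X - C ρ) * v₁))
          = ((Complex.normSq (z - ρ) : ℝ) : ℂ) * (aeval z u₁ * conj (aeval z v₁)) := by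
        rw [← Complex.mul_conj]
        simp
        ring
      rw [e, Complex.im_ofReal_mul] at this
      exact nonpos_of_mul_nonpos_right this (Complex.normSq_pos.2 hz0)
    obtain ⟨c₀, S, c, q, hc, hu⟩ := ih hv1 hs hud h1 hd
    refine ⟨c₀, S, c, fun σ => (X - C ρ) * q σ, ?_, ?_⟩
    · intro σ hσ
      refine ⟨(hc σ hσ).1, ?_⟩
      conv_lhs => rw [(hc σ hσ).2]
      ring
    · conv_lhs => rw [hu]
      rw [mul_add, Finset.mul_sum]
      congr 1
      · ring
      · exact Finset.sum_congr rfl fun _ _ => by ring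

/-! ### Means of roots of univariate polynomials -/

theorem splits_real_of_aeval_ne_zero {R : ℝ[X]} (h : ∀ z : ℂ, 0 < z.im → aeval z R ≠ 0) :
    R.Splits := by
  by_cases hR : R = 0
  · simp [hR]
  apply Splits.of_splits_map (algebraMap ℝ ℂ) (IsAlgClosed.splits _)
  intro z hz
  rw [mem_roots (map_ne_zero hR), IsRoot, eval_map_algebraMap] at hz
  refine ⟨z.re, ?_⟩
  have him : z.im = 0 := by
    rcases lt_trichotomy z.im 0 with h0 | h0 | h0
    · refine absurd ?_ (h (conj z) (by simpa using h0))
      rw [aeval_conj_complex, hz, map_zero]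
    · exact h0
    · exact absurd hz (h z h0)
  exact Complex.ext rfl (by simp [him])

theorem mul_coeff_add_coeff_eq_sum_roots {K : Type*} [Field K] {p : K[X]} (hp : p.Splits) {k : ℕ}
    (hk : 1 ≤ k) (hd : p.natDegree = k) (x : K) :
    k * x * p.coeff k + p.coeff (k - 1) = p.coeff k * (p.roots.map fun ρ => x - ρ).sum := by
  have h1 := hp.nextCoeff_eq_neg_sum_roots_mul_leadingCoeff
  rw [nextCoeff_of_natDegree_pos (by omega), leadingCoeff, hd] at h1
  have h2 := hp.natDegree_eq_card_roots
  rw [h1, Multiset.sum_map_sub]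
  simp only [Multiset.map_const', Multiset.sum_replicate, Multiset.map_id', ← h2, hd,
    nsmul_eq_mul]
  ring

theorem natDegree_eq_of_coeff_ne_zero {K : Type*} [Semiring K] {p : K[X]} {k : ℕ}
    (hd : p.natDegree ≤ k) (hc : p.coeff k ≠ 0) : p.natDegree = k :=
  le_antisymm hd (le_natDegree_of_ne_zero hc)

section Complex
variable {r : ℂ[X]} {k : ℕ}

theorem im_roots_nonpos (hr : r ≠ 0) (h : ∀ z : ℂ, 0 < z.im → r.eval z ≠ 0) :
    ∀ ρ ∈ r.roots, ρ.im ≤ 0 := by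
  intro ρ hρ
  by_contra! h0
  exact h ρ h0 ((mem_roots hr).1 hρ)

theorem im_multiset_sum (s : Multiset ℂ) : s.sum.im = (s.map Complex.im).sum := by
  exact map_multiset_sum Complex.imAddGroupHom s

theorem mul_coeff_add_coeff_ne_zero (hk : 1 ≤ k) (hd : r.natDegree ≤ k) (hc : r.coeff k ≠ 0)
    (h : ∀ z : ℂ, 0 < z.im → r.eval z ≠ 0) {z : ℂ} (hz : 0 < z.im) :
    k * z * r.coeff k + r.coeff (k - 1) ≠ 0 := by
  have hr : r ≠ 0 := fun h0 => hc (by simp [h0])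
  have hdeg := natDegree_eq_of_coeff_ne_zero hd hc
  have hs : r.Splits := IsAlgClosed.splits r
  have hcard := hs.natDegree_eq_card_roots
  rw [mul_coeff_add_coeff_eq_sum_roots hs hk hdeg]
  refine mul_ne_zero hc fun h0 => ?_
  have h1 := congrArg Complex.im h0
  rw [im_multiset_sum, Multiset.map_map, Complex.zero_im] at h1
  have h2 : (r.roots.map fun _ => z.im).sum ≤
      (r.roots.map (Complex.im ∘ fun ρ => z - ρ)).sum := by
    apply Multiset.sum_map_le_sum_map
    intro ρ hρ
    have := im_roots_nonpos hr h ρ hρ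
    simp
    linarith
  rw [h1, Multiset.map_const', Multiset.sum_replicate, ← hcard, hdeg, nsmul_eq_mul] at h2
  have : (0 : ℝ) < k * z.im := by
    have : (0 : ℝ) < k := by exact_mod_cast hk
    positivity
  linarith

theorem norm_coeff_mul_im_pow_le (hd : r.natDegree ≤ k) (hc : r.coeff k ≠ 0)
    (h : ∀ z : ℂ, 0 < z.im → r.eval z ≠ 0) {z : ℂ} (hz : 0 < z.im) :
    ‖r.coeff k‖ * z.im ^ k ≤ ‖r.eval z‖ := by
  have hr : r ≠ 0 := fun h0 => hc (by simp [h0])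
  have hdeg := natDegree_eq_of_coeff_ne_zero hd hc
  have hs : r.Splits := IsAlgClosed.splits r
  have hcard := hs.natDegree_eq_card_roots
  rw [hs.eval_eq_prod_roots, norm_mul, leadingCoeff, hdeg]
  refine mul_le_mul_of_nonneg_left ?_ (norm_nonneg _)
  have h2 : ∀ s : Multiset ℂ, (∀ ρ ∈ s, ρ.im ≤ 0) →
      z.im ^ s.card ≤ ‖(s.map fun ρ => z - ρ).prod‖ := by
    intro s
    induction s using Multiset.induction_on with
    | empty => simp
    | cons a s ih =>
      intro hs
      rw [Multiset.card_cons, Multiset.map_cons, Multiset.prod_cons, norm_mul, pow_succ']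
      refine mul_le_mul ?_ (ih fun ρ hρ => hs ρ (Multiset.mem_cons_of_mem hρ)) (by positivity)
        (norm_nonneg _)
      have := hs a (Multiset.mem_cons_self a s)
      have h3 := Complex.im_le_norm (z - a)
      rw [Complex.sub_im] at h3
      linarith
  have := h2 r.roots (im_roots_nonpos hr h)
  rwa [← hcard, hdeg] at this

theorem im_derivative_mul_conj_nonpos (h : ∀ z : ℂ, 0 < z.im → r.eval z ≠ 0) {z : ℂ}
    (hz : 0 < z.im) : (r.derivative.eval z * conj (r.eval z)).im ≤ 0 := by
  have hr : r ≠ 0 := fun h0 => h z hz (by simp [h0])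
  have hs : r.Splits := IsAlgClosed.splits r
  rw [hs.eval_derivative_eq_eval_mul_sum (h z hz), mul_right_comm, Complex.mul_conj,
    Complex.im_ofReal_mul]
  refine mul_nonpos_of_nonneg_of_nonpos (Complex.normSq_nonneg _) ?_
  rw [im_multiset_sum, Multiset.map_map]
  have h0 := Multiset.sum_map_le_sum_map (s := r.roots) (Complex.im ∘ fun ρ => 1 / (z - ρ))
    (fun _ => 0) ?_
  · simpa using h0
  intro ρ hρ
  have := im_roots_nonpos hr h ρ hρ
  simp only [Function.comp_apply, one_div, Complex.inv_im, Complex.sub_im]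
  exact div_nonpos_of_nonpos_of_nonneg (by linarith) (Complex.normSq_nonneg _)

end Complex

/-- The arithmetic-harmonic mean inequality, from the tangent line bound `a ≥ 2A - A² / a` at the
point `A = card s / K`. -/
theorem card_sq_div_le_sum {s : Multiset ℝ} (hs : ∀ a ∈ s, 0 < a) {K : ℝ} (hK : 0 < K)
    (h : (s.map fun a => 1 / a).sum ≤ K) : (s.card : ℝ) ^ 2 / K ≤ s.sum := by
  set A : ℝ := s.card / K with hA
  have h1 : (s.map fun a => 2 * A - A ^ 2 * (1 / a)).sum ≤ (s.map fun a => a).sum := by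
    apply Multiset.sum_map_le_sum_map
    intro a ha
    have ha0 := hs a ha
    have : a - (2 * A - A ^ 2 * (1 / a)) = (a - A) ^ 2 / a := by
      field_simp
      ring
    have h2 : 0 ≤ (a - A) ^ 2 / a := by positivity
    linarith
  rw [Multiset.sum_map_sub, Multiset.sum_map_mul_left (a := A ^ 2), Multiset.map_const',
    Multiset.sum_replicate, nsmul_eq_mul, Multiset.map_id'] at h1
  have h3 : A ^ 2 * (s.map fun a => 1 / a).sum ≤ A ^ 2 * K :=
    mul_le_mul_of_nonneg_left h (sq_nonneg A)
  have h4 : (s.card : ℝ) * (2 * A) - A ^ 2 * K = s.card ^ 2 / K := by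
    rw [hA]
    field_simp
    ring
  linarith

/-- How far the mean of the roots lies below the barrier. The largest of the gaps `t - ρ` is at
most `t`, since the roots are nonnegative; the other `k - 1` gaps have the sum of their inverses
bounded by `φ - 1 / t`, hence a large sum. -/
theorem gap_le_sum_sub_roots {s : Multiset ℝ} {k : ℕ} {t φ δ : ℝ} (hk : 2 ≤ k)
    (hcard : s.card = k) (h0 : ∀ ρ ∈ s, 0 ≤ ρ) (h1 : ∀ ρ ∈ s, ρ < t)
    (hφ : (s.map fun ρ => 1 / (t - ρ)).sum ≤ φ) (hφt : 1 / t < φ)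
    (hδ : k * δ = ((k : ℝ) - 1) ^ 2 / (φ - 1 / t)) {ρ x : ℝ} (hρ : ρ ∈ s) (hx : t - δ ≤ x) :
    t - ρ ≤ (s.map fun σ => x - σ).sum := by
  obtain ⟨s', rfl⟩ := Multiset.exists_cons_of_mem hρ
  have hc' : (s'.card : ℝ) = k - 1 := by
    rw [Multiset.card_cons] at hcard
    rw [← hcard]
    push_cast
    ring
  have hρ0 := h0 ρ hρ
  have hρ1 := h1 ρ hρ
  have h2 : 1 / t ≤ 1 / (t - ρ) := one_div_le_one_div_of_le (by linarith) (by linarith)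
  have h3 := card_sq_div_le_sum (s := s'.map fun σ => t - σ) (K := φ - 1 / t)
    (by
      intro a ha
      obtain ⟨σ, hσ, rfl⟩ := Multiset.mem_map.1 ha
      have := h1 σ (Multiset.mem_cons_of_mem hσ)
      linarith) (by linarith)
    (by
      rw [Multiset.map_map]
      rw [Multiset.map_cons, Multiset.sum_cons] at hφ
      simp only [Function.comp_def]
      linarith)
  rw [Multiset.card_map, hc', ← hδ] at h3
  have h4 : ((ρ ::ₘ s').map fun σ => t - σ).sum - k * (t - x)
      = ((ρ ::ₘ s').map fun σ => x - σ).sum := by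
    rw [Multiset.sum_map_sub, Multiset.sum_map_sub, Multiset.map_const', Multiset.map_const',
      Multiset.sum_replicate, Multiset.sum_replicate, nsmul_eq_mul, nsmul_eq_mul, hcard]
    ring
  rw [← h4, Multiset.map_cons, Multiset.sum_cons]
  have : (k : ℝ) * (t - x) ≤ k * δ := mul_le_mul_of_nonneg_left (by linarith) (by positivity)
  linarith

/-! ### Stability -/

/-- The relations between the functions `F n`, `n : ι → ℕ`, of the complex variables `y i` that
the analytic argument needs. For a determinant with variable blocks of size `k`, `F n` is the sum
of the principal minors that keep `n i` indices of each block `i`. As a function of `y i`, the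
one with `n i = k` is a polynomial of degree at most `k`; the one with `n i = k - 1` is its
derivative, and those with `n i = 1` and `n i = 0` are, up to a constant factor, its derivatives
of order `k - 1` and `k`. -/
structure SliceFamily {ι : Type*} [DecidableEq ι] (k : ℕ) (F : (ι → ℕ) → (ι → ℂ) → ℂ) : Prop where
  continuous : ∀ n, Continuous (F n)
  conj_apply : ∀ n y, F n (fun i => conj (y i)) = conj (F n y)
  slice : ∀ n i y, n i = k → ∃ r : ℂ[X], r.natDegree ≤ k ∧ ∀ x,
    F n (update y i x) = r.eval x ∧
    F (update n i (k - 1)) (update y i x) = r.derivative.eval x ∧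
    F (update n i 1) (update y i x) = k * x * r.coeff k + r.coeff (k - 1) ∧
    F (update n i 0) (update y i x) = r.coeff k

/-- The index vectors in play: each block is untouched (`k`), processed (`1`) or deleted (`0`). -/
def Admissible {ι : Type*} (k : ℕ) (n : ι → ℕ) : Prop :=
  ∀ i, n i = 0 ∨ n i = 1 ∨ n i = k

/-- The number of processed blocks. -/
def numOnes {ι : Type*} [Fintype ι] (n : ι → ℕ) : ℕ :=
  (Finset.univ.filter fun i => n i = 1).card

section Counting
variable {ι : Type*} [DecidableEq ι] {k : ℕ} {n : ι → ℕ}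

theorem Admissible.update (hn : Admissible k n) (i : ι) {a : ℕ} (ha : a = 0 ∨ a = 1 ∨ a = k) :
    Admissible k (update n i a) := by
  intro j
  by_cases hj : j = i
  · subst hj; simpa using ha
  · simpa [hj] using hn j

variable [Fintype ι]

theorem numOnes_update_le (i : ι) {a : ℕ} (ha : a ≠ 1) : numOnes (update n i a) ≤ numOnes n := by
  apply Finset.card_le_card
  intro j
  by_cases hj : j = i
  · subst hj; simp [ha]
  · simp [hj]

theorem numOnes_update_lt {i : ι} (hi : n i = 1) {a : ℕ} (ha : a ≠ 1) :
    numOnes (update n i a) < numOnes n := by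
  apply Finset.card_lt_card
  rw [Finset.ssubset_iff_of_subset]
  · exact ⟨i, by simpa using hi, by simp [ha]⟩
  · intro j
    by_cases hj : j = i
    · subst hj; simp [ha]
    · simp [hj]

/-- Induction on the number of processed blocks. -/
theorem Admissible.induction (hk : 2 ≤ k) {Q : (ι → ℕ) → Prop}
    (base : ∀ n, (∀ i, n i = 0 ∨ n i = k) → Q n)
    (step : ∀ c n i, Admissible k n → n i = k → numOnes n ≤ c →
      (∀ n', Admissible k n' → numOnes n' ≤ c → Q n') → Q (Function.update n i 1))
    (n : ι → ℕ) (hn : Admissible k n) : Q n := by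
  have key : ∀ c, ∀ n, Admissible k n → numOnes n ≤ c → Q n := by
    intro c
    induction c with
    | zero =>
      intro n hn hc
      refine base n fun i => ?_
      rcases hn i with h | h | h
      · exact Or.inl h
      · have : i ∈ Finset.univ.filter fun i => n i = 1 := by simpa using h
        have := Finset.card_pos.2 ⟨i, this⟩
        unfold numOnes at hc
        omega
      · exact Or.inr h
    | succ c ih =>
      intro n hn hc
      by_cases h1 : ∃ i, n i = 1
      · obtain ⟨i, hi⟩ := h1
        have := numOnes_update_lt (n := n) hi (a := k) (by omega)
        have h2 := step c (Function.update n i k) i (hn.update i (by simp)) (by simp) (by omega) ih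
        rwa [update_idem, ← hi, update_eq_self] at h2
      · push Not at h1
        exact base n fun i => by
          rcases hn i with h | h | h
          · exact Or.inl h
          · exact absurd h (h1 i)
          · exact Or.inr h
  exact key _ n hn le_rfl

end Counting

theorem le_of_forall_im_pos {ι : Type*} {f g : (ι → ℂ) → ℝ} (hf : Continuous f) (hg : Continuous g)
    (h : ∀ y, (∀ i, 0 < (y i).im) → f y ≤ g y) (y : ι → ℂ) (hy : ∀ i, 0 ≤ (y i).im) :
    f y ≤ g y := by
  set γ : ℝ → ι → ℂ := fun η i => y i + η * Complex.I
  have hγ : Continuous γ := by fun_prop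
  have h0 : γ 0 = y := by ext i; simp [γ]
  have hlim : ∀ {f : (ι → ℂ) → ℝ}, Continuous f →
      Filter.Tendsto (f ∘ γ) (nhdsWithin 0 (Set.Ioi 0)) (nhds (f y)) := by
    intro f hf
    have := (hf.comp hγ).tendsto 0
    rw [comp_apply, h0] at this
    exact this.mono_left nhdsWithin_le_nhds
  refine le_of_tendsto_of_tendsto (hlim hf) (hlim hg) ?_
  refine Filter.eventually_of_mem self_mem_nhdsWithin fun η hη => h _ fun i => ?_
  have := hy i
  have hη' : 0 < η := hη
  simp [γ]
  linarith

section Stability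
variable {ι : Type*} [DecidableEq ι] {k : ℕ} {F : (ι → ℕ) → (ι → ℂ) → ℂ}

/-- `f` has no zero with all variables in the open upper half plane. -/
def Stable (f : (ι → ℂ) → ℂ) : Prop :=
  ∀ y, (∀ i, 0 < (y i).im) → f y ≠ 0

theorem forall_update_im_pos {y : ι → ℂ} (hy : ∀ i, 0 < (y i).im) (i : ι) {z : ℂ}
    (hz : 0 < z.im) : ∀ j, 0 < (update y i z j).im := by
  intro j
  by_cases hj : j = i
  · subst hj; simpa using hz
  · simpa [hj] using hy j

theorem SliceFamily.slice_self (hF : SliceFamily k F) {n : ι → ℕ} {i : ι} (hi : n i = k)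
    (y : ι → ℂ) :
    ∃ r : ℂ[X], r.natDegree ≤ k ∧ (∀ x, F n (update y i x) = r.eval x) ∧
    F n y = r.eval (y i) ∧ F (update n i (k - 1)) y = r.derivative.eval (y i) ∧
    F (update n i 1) y = k * y i * r.coeff k + r.coeff (k - 1) ∧
    F (update n i 0) y = r.coeff k := by
  obtain ⟨r, hr, h⟩ := hF.slice n i y hi
  have h1 := h (y i)
  rw [update_eq_self] at h1
  exact ⟨r, hr, fun x => (h x).1, h1⟩

theorem SliceFamily.stable (hF : SliceFamily k F) [Fintype ι] (hk : 2 ≤ k)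
    (base : ∀ n, (∀ i, n i = 0 ∨ n i = k) → Stable (F n)) (n : ι → ℕ) (hn : Admissible k n) :
    Stable (F n) := by
  refine Admissible.induction hk base ?_ n hn
  intro c n i hn hi hc ih y hy
  obtain ⟨r, hr, h, -, -, h1, h0⟩ := hF.slice_self hi y
  rw [h1]
  refine mul_coeff_add_coeff_ne_zero (by omega) hr ?_ ?_ (hy i)
  · rw [← h0]
    exact ih _ (hn.update i (by simp)) ((numOnes_update_le i (by simp)).trans hc) y hy
  · intro z hz
    rw [← h]
    exact ih _ hn hc _ (forall_update_im_pos hy i hz)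

/-- A quantitative form of stability, which passes to the closed upper half plane by continuity. -/
theorem SliceFamily.norm_mul_im_pow_le (hF : SliceFamily k F) {n : ι → ℕ} {i : ι}
    (hi : n i = k) (hs : Stable (F n))
    (hs0 : Stable (F (update n i 0))) (y : ι → ℂ) (hy : ∀ i, 0 ≤ (y i).im) :
    ‖F (update n i 0) y‖ * (y i).im ^ k ≤ ‖F n y‖ := by
  refine le_of_forall_im_pos (f := fun y => ‖F (update n i 0) y‖ * (y i).im ^ k)
    (g := fun y => ‖F n y‖) ?_ (hF.continuous n).norm ?_ y hy
  · exact (hF.continuous _).norm.mul ((Complex.continuous_im.comp (continuous_apply i)).pow k)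
  · intro y hy
    obtain ⟨r, hr, h, h1, -, -, h0⟩ := hF.slice_self hi y
    simp only [h1, h0]
    refine norm_coeff_mul_im_pow_le hr ?_ ?_ (hy i)
    · rw [← h0]
      exact hs0 y hy
    · intro z hz
      rw [← h]
      exact hs _ (forall_update_im_pos hy i hz)

/-- The logarithmic derivative of a slice maps the upper half plane to the closed lower one; by
continuity the other variables may be real. -/
theorem SliceFamily.im_pred_mul_conj_nonpos (hF : SliceFamily k F) {n : ι → ℕ} {i : ι}
    (hi : n i = k)
    (hs : Stable (F n)) (y : ι → ℂ) (hy : ∀ i, 0 ≤ (y i).im) :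
    (F (update n i (k - 1)) y * conj (F n y)).im ≤ 0 := by
  refine le_of_forall_im_pos (f := fun y => (F (update n i (k - 1)) y * conj (F n y)).im)
    (g := fun _ => 0) ?_ continuous_const ?_ y hy
  · exact Complex.continuous_im.comp
      ((hF.continuous _).mul (Complex.continuous_conj.comp (hF.continuous n)))
  · intro y hy
    obtain ⟨r, hr, h, h1, h2, -, -⟩ := hF.slice_self hi y
    simp only [h1, h2]
    refine im_derivative_mul_conj_nonpos ?_ (hy i)
    intro z hz
    rw [← h]
    exact hs _ (forall_update_im_pos hy i hz)

/-- For a processed block `i`, the function `F n` is affine in `y i`; its zero is a function of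
the other variables that maps the upper half plane to the closed lower one. -/
theorem SliceFamily.im_zero_mul_conj_nonpos (hF : SliceFamily k F) {n : ι → ℕ} {i : ι}
    (hk : 1 ≤ k) (hi : n i = k)
    (hs1 : Stable (F (update n i 1))) (hs0 : Stable (F (update n i 0)))
    (y : ι → ℂ) (hy : ∀ i, 0 ≤ (y i).im) :
    (-F (update n i 1) (update y i 0) * conj (F (update n i 0) y)).im ≤ 0 := by
  refine le_of_forall_im_pos
    (f := fun y => (-F (update n i 1) (update y i 0) * conj (F (update n i 0) y)).im)
    (g := fun _ => 0) ?_ continuous_const ?_ y hy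
  · refine Complex.continuous_im.comp
      (((hF.continuous _).comp ?_).neg.mul (Complex.continuous_conj.comp (hF.continuous _)))
    exact continuous_id.update i continuous_const
  · intro y hy
    obtain ⟨r, hr, h⟩ := hF.slice n i y hi
    have e1 := (h 0).2.2.1
    have e0 := (h (y i)).2.2.2
    rw [update_eq_self] at e0
    rw [mul_zero, zero_mul, zero_add] at e1
    simp only [e1, e0]
    have hc : r.coeff k ≠ 0 := by
      rw [← e0]
      exact hs0 y hy
    have hk0 : (k : ℂ) ≠ 0 := by exact_mod_cast (by omega : k ≠ 0)
    by_contra! hpos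
    -- otherwise the zero itself would lie in the upper half plane
    set z : ℂ := -r.coeff (k - 1) / (k * r.coeff k) with hz
    have hzim : 0 < z.im := by
      have e : -r.coeff (k - 1) * conj (r.coeff k)
          = ((k * Complex.normSq (r.coeff k) : ℝ) : ℂ) * z := by
        rw [hz]
        push_cast
        rw [← Complex.mul_conj]
        field_simp
      rw [e, Complex.im_ofReal_mul] at hpos
      by_contra! h0
      exact absurd hpos (not_lt.2 (mul_nonpos_of_nonneg_of_nonpos
        (mul_nonneg (Nat.cast_nonneg k) (Complex.normSq_nonneg _)) h0))
    refine hs1 _ (forall_update_im_pos hy i hzim) ?_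
    rw [(h z).2.2.1, hz]
    field_simp
    ring

end Stability

/-! ### The barrier argument -/

section Real
variable {ι : Type*} {k : ℕ} {F : (ι → ℕ) → (ι → ℂ) → ℂ}

/-- The restriction of `F n` to real variables, where a `SliceFamily` takes real values. -/
noncomputable def onReal (F : (ι → ℕ) → (ι → ℂ) → ℂ) (n : ι → ℕ) (y : ι → ℝ) : ℝ :=
  (F n fun i => (y i : ℂ)).re

variable [DecidableEq ι]

theorem ofReal_update (y : ι → ℝ) (i : ι) (x : ℝ) :
    (fun j => ((update y i x j : ℝ) : ℂ)) = update (fun j => (y j : ℂ)) i (x : ℂ) := by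
  ext j
  by_cases hj : j = i
  · subst hj; simp
  · simp [hj]

theorem SliceFamily.apply_ofReal (hF : SliceFamily k F) (n : ι → ℕ) (y : ι → ℝ) :
    F n (fun i => (y i : ℂ)) = (onReal F n y : ℂ) := by
  have := hF.conj_apply n fun i => (y i : ℂ)
  simp only [Complex.conj_ofReal] at this
  exact (Complex.conj_eq_iff_re.1 this.symm).symm

theorem SliceFamily.real_slice (hF : SliceFamily k F) {n : ι → ℕ} {i : ι} (hi : n i = k)
    (y : ι → ℝ) : ∃ R : ℝ[X], R.natDegree ≤ k ∧
    (∀ z : ℂ, F n (update (fun j => (y j : ℂ)) i z) = aeval z R) ∧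
    (∀ x : ℝ, onReal F n (update y i x) = R.eval x) ∧
    (∀ x : ℝ, onReal F (update n i (k - 1)) (update y i x) = R.derivative.eval x) ∧
    (∀ x : ℝ, onReal F (update n i 1) (update y i x) = k * x * R.coeff k + R.coeff (k - 1)) ∧
    (∀ x : ℝ, onReal F (update n i 0) (update y i x) = R.coeff k) := by
  obtain ⟨r, hr, h⟩ := hF.slice n i (fun j => (y j : ℂ)) hi
  obtain ⟨R, rfl⟩ := exists_real_polynomial r (by
    intro x
    rw [← (h x).1, ← ofReal_update, hF.apply_ofReal, Complex.ofReal_im])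
  rw [natDegree_map] at hr
  simp only [eval_map_algebraMap, derivative_map, coeff_map, Complex.coe_algebraMap] at h
  refine ⟨R, hr, fun z => (h z).1, ?_, ?_, ?_, ?_⟩ <;> intro x <;> have hx := h x <;>
    simp only [← ofReal_update, hF.apply_ofReal, aeval_ofReal_complex] at hx
  · exact_mod_cast hx.1
  · exact_mod_cast hx.2.1
  · exact_mod_cast hx.2.2.1
  · exact_mod_cast hx.2.2.2

theorem update_im_nonneg (y : ι → ℝ) (i : ι) {z : ℂ} (hz : 0 < z.im) :
    ∀ j, 0 ≤ (update (fun j => (y j : ℂ)) i z j).im := by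
  intro j
  by_cases hj : j = i
  · subst hj; simpa using hz.le
  · simp [hj]

/-- A slice in a real direction is real-rooted as soon as its leading coefficient does not
vanish: this rules out that the zeros reach the real axis only in the limit. -/
theorem SliceFamily.splits_slice (hF : SliceFamily k F) {n : ι → ℕ} {i : ι} (hi : n i = k)
    (hs : Stable (F n)) (hs0 : Stable (F (update n i 0))) {y : ι → ℝ} {R : ℝ[X]}
    (hR : ∀ z : ℂ, F n (update (fun j => (y j : ℂ)) i z) = aeval z R)
    (hc : ∀ x : ℝ, onReal F (update n i 0) (update y i x) = R.coeff k)
    (hc0 : R.coeff k ≠ 0) : R.Splits := by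
  apply splits_real_of_aeval_ne_zero
  intro z hz h0
  have h1 := hF.norm_mul_im_pow_le hi hs hs0 _ (update_im_nonneg y i hz)
  obtain ⟨r, -, h⟩ := hF.slice n i (fun j => (y j : ℂ)) hi
  have e : F (update n i 0) (update (fun j => (y j : ℂ)) i z) = (R.coeff k : ℂ) := by
    rw [(h z).2.2.2, ← hc 0, ← hF.apply_ofReal, ofReal_update, (h _).2.2.2]
  rw [hR, h0, e, norm_zero, update_self, Complex.norm_real] at h1
  have : 0 < ‖R.coeff k‖ * z.im ^ k := mul_pos (norm_pos_iff.2 hc0) (pow_pos hz k)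
  linarith

end Real

/-- The point above the zeros: the variable of a block starts at `t` and drops to `t - δ` when the
block is processed. -/
def base {ι : Type*} (t δ : ℝ) (n : ι → ℕ) (i : ι) : ℝ := if n i = 1 then t - δ else t

theorem base_of_ne_one {ι : Type*} {t δ : ℝ} {n : ι → ℕ} {i : ι} (ha : n i ≠ 1) :
    base t δ n i = t := by
  simp [base, ha]

section Barrier
variable {ι : Type*} [DecidableEq ι] {k : ℕ} {F : (ι → ℕ) → (ι → ℂ) → ℂ}

/-- What the barrier argument carries along: `F n` is positive above the base point; the
logarithmic derivative with respect to an untouched block is at most `φ` there; and as a function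
of the variable of an untouched block, `F n` has no negative zeros. -/
structure Barrier (F : (ι → ℕ) → (ι → ℂ) → ℂ) (k : ℕ) (t δ φ : ℝ) (n : ι → ℕ) : Prop where
  pos : ∀ y, (∀ i, base t δ n i ≤ y i) → 0 < onReal F n y
  logDeriv_le : ∀ j, n j = k → ∀ y, (∀ i, base t δ n i ≤ y i) →
    onReal F (update n j (k - 1)) y ≤ φ * onReal F n y
  ne_zero : ∀ j, n j = k → ∀ y, (∀ i, i ≠ j → base t δ n i ≤ y i) → ∀ x < 0,
    onReal F n (update y j x) ≠ 0

theorem base_update_of_ne {t δ : ℝ} {n : ι → ℕ} {i j : ι} (h : j ≠ i) (a : ℕ) :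
    base t δ (update n i a) j = base t δ n j := by
  simp [base, h]

variable {t δ φ : ℝ}

/-- The univariate heart of a processing step, see `gap_le_sum_sub_roots`: the mean of the roots
of the slice in the processed direction lies so far below `t` that it stays below `t - δ`, even by
a margin measured by any of the gaps `t - ρ`. -/
theorem Barrier.exists_slice (hF : SliceFamily k F) (hk : 2 ≤ k) (hφt : 1 / t < φ)
    (hδ : k * δ = ((k : ℝ) - 1) ^ 2 / (φ - 1 / t)) {n : ι → ℕ} {i : ι} (hi : n i = k)
    (hs : Stable (F n)) (hs0 : Stable (F (update n i 0)))
    (hB : Barrier F k t δ φ n) (hB0 : Barrier F k t δ φ (update n i 0))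
    {y : ι → ℝ} (hy : ∀ j, j ≠ i → base t δ n j ≤ y j) :
    ∃ R : ℝ[X], R.natDegree = k ∧ 0 < R.coeff k ∧ R.Splits ∧
    (∀ ρ, R.IsRoot ρ → ρ < t) ∧
    (∀ ρ, R.IsRoot ρ → ∀ x, t - δ ≤ x →
      R.coeff k * (t - ρ) ≤ k * x * R.coeff k + R.coeff (k - 1)) ∧
    (∀ z : ℂ, F n (update (fun j => (y j : ℂ)) i z) = aeval z R) ∧
    (∀ x : ℝ, onReal F n (update y i x) = R.eval x) ∧
    (∀ x : ℝ, onReal F (update n i 1) (update y i x) = k * x * R.coeff k + R.coeff (k - 1)) ∧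
    (∀ x : ℝ, onReal F (update n i 0) (update y i x) = R.coeff k) := by
  obtain ⟨R, hd, hz, hx, hx', h1, h0⟩ := hF.real_slice hi y
  have hk1 : n i ≠ 1 := by omega
  have habove : ∀ x, t ≤ x → ∀ j, base t δ n j ≤ update y i x j := by
    intro x hxt j
    by_cases hj : j = i
    · subst hj; simpa [base_of_ne_one hk1] using hxt
    · simpa [hj] using hy j hj
  have hc : 0 < R.coeff k := by
    rw [← h0 t]
    apply hB0.pos
    intro j
    by_cases hj : j = i
    · subst hj; simp [base]
    · simpa [hj, base_update_of_ne] using hy j hj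
  have hdeg := natDegree_eq_of_coeff_ne_zero hd hc.ne'
  have hR0 : R ≠ 0 := fun h => by simp [h] at hc
  have hsp : R.Splits := hF.splits_slice hi hs hs0 hz h0 hc.ne'
  have hlt : ∀ ρ, R.IsRoot ρ → ρ < t := by
    intro ρ hρ
    by_contra! hge
    have := hB.pos _ (habove ρ hge)
    rw [hx, hρ.eq_zero] at this
    exact this.false
  have hnn : ∀ ρ, R.IsRoot ρ → 0 ≤ ρ := by
    intro ρ hρ
    by_contra! hneg
    exact hB.ne_zero i hi y hy ρ hneg (by rw [hx, hρ.eq_zero])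
  have hRt : 0 < R.eval t := by
    rw [← hx]
    exact hB.pos _ (habove t le_rfl)
  have hsum : (R.roots.map fun ρ => 1 / (t - ρ)).sum ≤ φ := by
    have h2 := hB.logDeriv_le i hi _ (habove t le_rfl)
    rw [hx, hx', hsp.eval_derivative_eq_eval_mul_sum hRt.ne', mul_comm φ] at h2
    exact le_of_mul_le_mul_left h2 hRt
  refine ⟨R, hdeg, hc, hsp, hlt, ?_, hz, hx, h1, h0⟩
  intro ρ hρ x hxδ
  rw [mul_coeff_add_coeff_eq_sum_roots hsp (by omega) hdeg]
  refine mul_le_mul_of_nonneg_left ?_ hc.le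
  exact gap_le_sum_sub_roots hk (by rw [← hsp.natDegree_eq_card_roots, hdeg])
    (fun σ hσ => hnn σ ((mem_roots hR0).1 hσ)) (fun σ hσ => hlt σ ((mem_roots hR0).1 hσ))
    hsum hφt hδ ((mem_roots hR0).2 hρ) hxδ

/-- Positivity survives the processing of the block `i`. -/
theorem Barrier.pos_step (hF : SliceFamily k F) (hk : 2 ≤ k) (hφt : 1 / t < φ)
    (hδ : k * δ = ((k : ℝ) - 1) ^ 2 / (φ - 1 / t)) {n : ι → ℕ} {i : ι} (hi : n i = k)
    (hs : Stable (F n)) (hs0 : Stable (F (update n i 0)))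
    (hB : Barrier F k t δ φ n) (hB0 : Barrier F k t δ φ (update n i 0))
    {y : ι → ℝ} (hy : ∀ j, base t δ (update n i 1) j ≤ y j) :
    0 < onReal F (update n i 1) y := by
  obtain ⟨R, hdeg, hc, hsp, hlt, hgap, -, -, h1, -⟩ := hB.exists_slice hF hk hφt hδ hi hs hs0 hB0
    (y := y) (fun j hj => by simpa [base_update_of_ne hj] using hy j)
  have hyi : t - δ ≤ y i := by simpa [base] using hy i
  obtain ⟨ρ, hρ⟩ := hsp.exists_eval_eq_zero (by
    rw [degree_eq_natDegree (fun h => by simp [h] at hc), hdeg]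
    exact_mod_cast (by omega : k ≠ 0))
  have h2 := h1 (y i)
  rw [update_eq_self] at h2
  rw [h2]
  exact (mul_pos hc (sub_pos.2 (hlt ρ hρ))).trans_le (hgap ρ hρ _ hyi)

/-- In the notation of the proof, the logarithmic derivative in the block `j` is
`c₀ + ∑ c ρ / (x - ρ)` before the processing of the block `i` and `c₀ + (∑ c ρ) / ∑ (x - ρ)`
afterwards. By `Barrier.exists_slice` the denominator `∑ (x - ρ)` at `x ≥ t - δ` is at least each
of the `t - ρ`. -/
theorem Barrier.logDeriv_le_step (hF : SliceFamily k F) (hk : 2 ≤ k) (hφt : 1 / t < φ)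
    (hδ : k * δ = ((k : ℝ) - 1) ^ 2 / (φ - 1 / t)) {n : ι → ℕ} {i j : ι} (hi : n i = k)
    (hs : Stable (F n)) (hs0 : Stable (F (update n i 0)))
    (hB : Barrier F k t δ φ n) (hB0 : Barrier F k t δ φ (update n i 0))
    (hij : j ≠ i) (hj : n j = k)
    {y : ι → ℝ} (hy : ∀ j, base t δ (update n i 1) j ≤ y j) :
    onReal F (update (update n i 1) j (k - 1)) y ≤ φ * onReal F (update n i 1) y := by
  have hy' : ∀ l, l ≠ i → base t δ n l ≤ y l := fun l hl => by
    simpa [base_update_of_ne hl] using hy l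
  have hyi : t - δ ≤ y i := by simpa [base] using hy i
  obtain ⟨R, hdeg, hc, hsp, hlt, hgap, hz, hx, h1, h0⟩ :=
    hB.exists_slice hF hk hφt hδ hi hs hs0 hB0 hy'
  obtain ⟨U, hUd, hUz, hUx, -, hU1, hU0⟩ := hF.real_slice (n := update n j (k - 1)) (i := i)
    (by simpa [hij.symm] using hi) y
  simp only [update_comm hij] at hU1 hU0
  have hR0 : R ≠ 0 := fun h => by simp [h] at hc
  obtain ⟨c₀, S, c, q, hq, hU⟩ := exists_partial_fractions (u := U) hR0 hsp
    (hUd.trans hdeg.ge) (by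
      intro z hzim
      rw [← hUz, ← hz]
      exact hF.im_pred_mul_conj_nonpos hj hs _ (update_im_nonneg y i hzim))
  have hqd : ∀ ρ ∈ S, (q ρ).natDegree + 1 = k ∧ (q ρ).coeff (k - 1) = R.coeff k := by
    intro ρ hρ
    have hq0 : q ρ ≠ 0 := fun h => hR0 (by rw [(hq ρ hρ).2, h, mul_zero])
    have hd : (q ρ).natDegree + 1 = k := by
      rw [← hdeg, (hq ρ hρ).2, natDegree_mul (X_sub_C_ne_zero ρ) hq0, natDegree_X_sub_C, add_comm]
    refine ⟨hd, ?_⟩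
    have e : (q ρ).leadingCoeff = R.leadingCoeff := by
      conv_rhs => rw [(hq ρ hρ).2, leadingCoeff_mul, leadingCoeff_X_sub_C, one_mul]
    rw [leadingCoeff, leadingCoeff, hdeg] at e
    rw [← e]
    congr 1
    omega
  -- the coefficients of degree `k` and `k - 1` of the partial fraction expansion
  have hUk : U.coeff k = c₀ * R.coeff k := by
    rw [hU, coeff_add, coeff_C_mul, finsetSum_coeff, Finset.sum_eq_zero, add_zero]
    intro ρ hρ
    have := (hqd ρ hρ).1
    rw [coeff_C_mul, coeff_eq_zero_of_natDegree_lt (by omega), mul_zero]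
  have hUk1 : U.coeff (k - 1) = c₀ * R.coeff (k - 1) + R.coeff k * ∑ ρ ∈ S, c ρ := by
    rw [hU, coeff_add, coeff_C_mul, finsetSum_coeff, Finset.mul_sum]
    congr 1
    refine Finset.sum_congr rfl fun ρ hρ => ?_
    rw [coeff_C_mul, (hqd ρ hρ).2, mul_comm]
  have habove : ∀ l, base t δ n l ≤ update y i t l := by
    intro l
    by_cases hl : l = i
    · subst hl; simp [base_of_ne_one (show n l ≠ 1 by omega)]
    · simpa [hl] using hy' l hl
  have hRt : 0 < R.eval t := by
    rw [← hx]
    exact hB.pos _ habove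
  have hUt : U.eval t ≤ φ * R.eval t := by
    rw [← hx, ← hUx]
    exact hB.logDeriv_le j hj _ habove
  have hroot : ∀ ρ ∈ S, R.IsRoot ρ := by
    intro ρ hρ
    rw [(hq ρ hρ).2]
    simp
  have hsum : c₀ + ∑ ρ ∈ S, c ρ / (t - ρ) ≤ φ := by
    have e : U.eval t = R.eval t * (c₀ + ∑ ρ ∈ S, c ρ / (t - ρ)) := by
      rw [hU, eval_add, eval_mul, eval_C, eval_finsetSum, mul_add, Finset.mul_sum, mul_comm c₀]
      congr 1
      refine Finset.sum_congr rfl fun ρ hρ => ?_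
      have h2 : t - ρ ≠ 0 := (sub_pos.2 (hlt ρ (hroot ρ hρ))).ne'
      have h3 : R.eval t = (t - ρ) * (q ρ).eval t := by
        conv_lhs => rw [(hq ρ hρ).2]
        simp
      rw [h3, eval_mul, eval_C]
      field_simp
    rw [e, mul_comm φ] at hUt
    exact le_of_mul_le_mul_left hUt hRt
  have e1 := h1 (y i)
  have e2 := hU1 (y i)
  rw [update_eq_self] at e1 e2
  rw [e1, e2, hUk, hUk1]
  set G := k * y i * R.coeff k + R.coeff (k - 1) with hG
  have hGρ : ∀ ρ ∈ S, R.coeff k * c ρ ≤ G * (c ρ / (t - ρ)) := by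
    intro ρ hρ
    have h2 : 0 < t - ρ := sub_pos.2 (hlt ρ (hroot ρ hρ))
    have h3 := mul_le_mul_of_nonneg_right (hgap ρ (hroot ρ hρ) _ hyi) (div_nonneg (hq ρ hρ).1 h2.le)
    calc R.coeff k * c ρ = R.coeff k * (t - ρ) * (c ρ / (t - ρ)) := by field_simp
      _ ≤ _ := h3
  have hG0 : 0 ≤ G := by
    have := hB.pos_step hF hk hφt hδ hi hs hs0 hB0 hy
    rw [e1] at this
    exact this.le
  calc k * y i * (c₀ * R.coeff k) + (c₀ * R.coeff (k - 1) + R.coeff k * ∑ ρ ∈ S, c ρ)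
      = c₀ * G + ∑ ρ ∈ S, R.coeff k * c ρ := by rw [Finset.mul_sum]; ring
    _ ≤ c₀ * G + ∑ ρ ∈ S, G * (c ρ / (t - ρ)) := by
        exact add_le_add_right (Finset.sum_le_sum hGρ) _
    _ = (c₀ + ∑ ρ ∈ S, c ρ / (t - ρ)) * G := by rw [← Finset.mul_sum]; ring
    _ ≤ φ * G := mul_le_mul_of_nonneg_right hsum hG0

/-- The mean root in the processed variable is a nonincreasing function of an untouched variable
`x` on the half-line `x < 0`, so it does not exceed its value at `x = -∞`. That value is the mean
root after deletion of the untouched block, which is below the base point. -/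
theorem Barrier.ne_zero_step (hF : SliceFamily k F) (hk : 2 ≤ k) {n : ι → ℕ} {i j : ι}
    (hi : n i = k) (hs0 : Stable (F (update n i 0))) (hs1 : Stable (F (update n i 1)))
    (hs00 : Stable (F (update (update n i 0) j 0)))
    (hB0 : Barrier F k t δ φ (update n i 0))
    (hB00 : ∀ y, (∀ l, base t δ (update (update n i 0) j 0) l ≤ y l) →
      0 < onReal F (update (update n i 0) j 0) y)
    (hpos : ∀ y, (∀ l, base t δ (update (update n j 0) i 1) l ≤ y l) →
      0 < onReal F (update (update n j 0) i 1) y)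
    (hij : j ≠ i) (hj : n j = k)
    {y : ι → ℝ} (hy : ∀ l, l ≠ j → base t δ (update n i 1) l ≤ y l) {x : ℝ} (hx : x < 0) :
    onReal F (update n i 1) (update y j x) ≠ 0 := by
  have hk0 : (0 : ℝ) < k := by exact_mod_cast (by omega : 0 < k)
  have hyi : t - δ ≤ y i := by simpa [base] using hy i hij.symm
  -- `V` is the leading coefficient in the variable `y i`, as a function of the variable `y j`
  obtain ⟨V, hVd, hVz, hVx, -, -, hV0⟩ := hF.real_slice (n := update n i 0) (i := j)
    (by simpa [hij] using hj) (update y i t)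
  -- `U` is the constant coefficient
  obtain ⟨U, hUd, hUz, hUx, -, -, hU0⟩ := hF.real_slice (n := update n i 1) (i := j)
    (by simpa [hij] using hj) (update y i 0)
  have hVk : 0 < V.coeff k := by
    rw [← hV0 t]
    apply hB00
    intro l
    by_cases hl : l = j
    · subst hl; simp [base]
    by_cases hl' : l = i
    · subst hl'; simp [base, hij.symm]
    · simpa [hl, hl', base] using hy l hl
  have hVsp : V.Splits := hF.splits_slice (by simpa [hij] using hj) hs0 hs00 hVz hV0 hVk.ne'
  have hV0' : V ≠ 0 := fun h => by simp [h] at hVk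
  have hVdeg := natDegree_eq_of_coeff_ne_zero hVd hVk.ne'
  have hVnn : ∀ σ, V.IsRoot σ → 0 ≤ σ := by
    intro σ hσ
    by_contra! hneg
    refine hB0.ne_zero j (by simpa [hij] using hj) (update y i t) ?_ σ hneg
      (by rw [hVx, hσ.eq_zero])
    intro l hl
    by_cases hl' : l = i
    · subst hl'; simp [base]
    · simpa [hl, hl', base] using hy l hl
  -- the coefficients of `F` in `y i`, at real points
  have hcoef : ∀ w : ι → ℝ, onReal F (update n i 1) w
      = k * w i * onReal F (update n i 0) (update w i t)
        + onReal F (update n i 1) (update w i 0) := by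
    intro w
    obtain ⟨R, -, -, -, -, h1, h0⟩ := hF.real_slice hi w
    have e := h1 (w i)
    rw [update_eq_self] at e
    rw [e, h0, h1]
    ring
  have hcoef0 : ∀ w : ι → ℝ, onReal F (update (update n j 0) i 1) w
      = k * w i * onReal F (update (update n j 0) i 0) (update w i t)
        + onReal F (update (update n j 0) i 1) (update w i 0) := by
    intro w
    obtain ⟨R, -, -, -, -, h1, h0⟩ := hF.real_slice (n := update n j 0) (i := i)
      (by simpa [hij.symm] using hi) w
    have e := h1 (w i)
    rw [update_eq_self] at e
    rw [e, h0, h1]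
    ring
  obtain ⟨c₀, S, c, q, hq, hU⟩ := exists_partial_fractions (u := -U) hV0' hVsp
    (by rw [natDegree_neg]; exact hUd.trans hVdeg.ge) (by
      intro z hz
      have h := hF.im_zero_mul_conj_nonpos (by omega) hi hs1 hs0 _
        (update_im_nonneg (update y i t) j hz)
      rw [hVz, update_comm hij, ofReal_update, update_idem] at h
      have e := hUz z
      rw [ofReal_update, update_comm hij.symm, Complex.ofReal_zero] at e
      rw [map_neg, ← e, update_comm hij]
      convert h using 5)
  have hUk : -U.coeff k = c₀ * V.coeff k := by
    rw [← coeff_neg, hU, coeff_add, coeff_C_mul, finsetSum_coeff, Finset.sum_eq_zero, add_zero]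
    intro ρ hρ
    have hq0 : q ρ ≠ 0 := fun h => hV0' (by rw [(hq ρ hρ).2, h, mul_zero])
    have hd : (q ρ).natDegree + 1 = k := by
      rw [← hVdeg, (hq ρ hρ).2, natDegree_mul (X_sub_C_ne_zero ρ) hq0, natDegree_X_sub_C, add_comm]
    rw [coeff_C_mul, coeff_eq_zero_of_natDegree_lt (by omega), mul_zero]
  -- the mean root at `x = -∞`
  have hc₀ : c₀ < k * y i := by
    have h := hpos (update y j t) (by
      intro l
      by_cases hl : l = j
      · subst hl; simp [base, hij]
      by_cases hl' : l = i
      · subst hl'; simpa [base, hij.symm] using hyi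
      · simpa [hl, hl', base] using hy l hl)
    rw [hcoef0] at h
    rw [update_comm hij, update_comm hij, update_comm hij, update_comm hij, hV0, hU0,
      update_of_ne hij.symm] at h
    exact lt_of_mul_lt_mul_right (by linarith) hVk.le
  have hVx0 : V.eval x ≠ 0 := fun h => absurd (hVnn x h) (not_le.2 hx)
  have hUV : -U.eval x / V.eval x ≤ c₀ := by
    have e : -U.eval x / V.eval x = c₀ + ∑ σ ∈ S, c σ * ((q σ).eval x / V.eval x) := by
      rw [← eval_neg, hU, eval_add, eval_mul, eval_C, eval_finsetSum, add_div,
        mul_div_cancel_right₀ _ hVx0, Finset.sum_div]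
      congr 1
      exact Finset.sum_congr rfl fun σ _ => by rw [eval_mul, eval_C, mul_div_assoc]
    rw [e]
    have : ∑ σ ∈ S, c σ * ((q σ).eval x / V.eval x) ≤ 0 := by
      refine Finset.sum_nonpos fun σ hσ => mul_nonpos_of_nonneg_of_nonpos (hq σ hσ).1 ?_
      have hσ0 : 0 ≤ σ := hVnn σ (by rw [(hq σ hσ).2]; simp)
      have h3 : V.eval x = (x - σ) * (q σ).eval x := by
        conv_lhs => rw [(hq σ hσ).2]
        simp
      rw [h3] at hVx0 ⊢
      have hq0 : (q σ).eval x ≠ 0 := right_ne_zero_of_mul hVx0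
      rw [mul_comm, div_mul_cancel_left₀ hq0]
      exact inv_nonpos.2 (by linarith)
    linarith
  intro h
  rw [hcoef, update_comm hij, update_comm hij, hVx, hUx, update_of_ne hij.symm] at h
  have : -U.eval x / V.eval x = k * y i := by
    rw [div_eq_iff hVx0]
    linarith
  linarith

/-- The barrier survives the processing of any number of blocks. -/
theorem SliceFamily.barrier [Fintype ι] (hF : SliceFamily k F) (hk : 2 ≤ k) (hφt : 1 / t < φ)
    (hδ : k * δ = ((k : ℝ) - 1) ^ 2 / (φ - 1 / t))
    (hs : ∀ n, Admissible k n → Stable (F n))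
    (h : ∀ n, (∀ i, n i = 0 ∨ n i = k) → Barrier F k t δ φ n) (n : ι → ℕ) (hn : Admissible k n) :
    Barrier F k t δ φ n := by
  refine Admissible.induction hk h ?_ n hn
  intro c n i hn hi hc ih
  have hn0 : Admissible k (update n i 0) := hn.update i (by simp)
  have hc0 : ∀ {n : ι → ℕ}, numOnes n ≤ c → ∀ i, numOnes (update n i 0) ≤ c := fun h i =>
    (numOnes_update_le i (by simp)).trans h
  have hpos : ∀ n : ι → ℕ, Admissible k n → n i = k → numOnes n ≤ c → ∀ y,
      (∀ j, base t δ (update n i 1) j ≤ y j) → 0 < onReal F (update n i 1) y := by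
    intro n hn hi hc y hy
    have hn0 : Admissible k (update n i 0) := hn.update i (by simp)
    exact (ih n hn hc).pos_step hF hk hφt hδ hi (hs n hn) (hs _ hn0) (ih _ hn0 (hc0 hc i)) hy
  refine ⟨hpos n hn hi hc, ?_, ?_⟩
  · intro j hj y hy
    have hij : j ≠ i := by
      rintro rfl
      rw [update_self] at hj
      omega
    rw [update_of_ne hij] at hj
    exact (ih n hn hc).logDeriv_le_step hF hk hφt hδ hi (hs n hn) (hs _ hn0)
      (ih _ hn0 (hc0 hc i)) hij hj hy
  · intro j hj y hy x hx
    have hij : j ≠ i := by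
      rintro rfl
      rw [update_self] at hj
      omega
    rw [update_of_ne hij] at hj
    have hn00 : Admissible k (update (update n i 0) j 0) := hn0.update j (by simp)
    exact Barrier.ne_zero_step hF hk hi (hs _ hn0) (hs _ (hn.update i (by simp))) (hs _ hn00)
      (ih _ hn0 (hc0 hc i)) (ih _ hn00 (hc0 (hc0 hc i) j)).pos
      (hpos _ (hn.update j (by simp)) (by rw [update_of_ne hij.symm, hi]) (hc0 hc j))
      hij hj hy hx

end Barrier

/-! ### Sums of principal minors -/

section RowDet
variable {N : Type*} [Fintype N] [DecidableEq N]

/-- The matrix `M` with the rows outside `T` replaced by those of the identity matrix. -/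
def keepRows (M : Matrix N N ℂ) (T : Finset N) : N → N → ℂ :=
  fun p q => if p ∈ T then M p q else if p = q then 1 else 0

/-- The principal minor of `M` on `T`, written as a determinant of full size so that it is
multilinear in rows whose index set does not depend on `T`. -/
def minor (M : Matrix N N ℂ) (T : Finset N) : ℂ := (Matrix.of (keepRows M T)).det

theorem minor_congr {M M' : Matrix N N ℂ} {T : Finset N} (h : ∀ p ∈ T, M p = M' p) :
    minor M T = minor M' T := by
  unfold minor
  congr 1
  ext p q
  by_cases hp : p ∈ T
  · simp [keepRows, hp, h p hp]
  · simp [keepRows, hp]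

theorem minor_eq_det_submatrix (M : Matrix N N ℂ) (T : Finset N) :
    minor M T = (M.submatrix (fun t : T => (t : N)) (fun t : T => (t : N))).det := by
  unfold minor
  rw [Matrix.twoBlockTriangular_det _ (fun p => p ∈ T)]
  · have h2 : (Matrix.of (keepRows M T)).toSquareBlockProp (fun p => ¬ p ∈ T) = 1 := by
      ext ⟨p, hp⟩ ⟨q, hq⟩
      simp [keepRows, Matrix.toSquareBlockProp, hp, Matrix.one_apply]
    have h1 : (Matrix.of (keepRows M T)).toSquareBlockProp (fun p => p ∈ T)
        = M.submatrix (fun t : T => (t : N)) (fun t : T => (t : N)) := by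
      ext ⟨p, hp⟩ ⟨q, hq⟩
      simp [keepRows, Matrix.toSquareBlockProp, hp]
    rw [h2, Matrix.det_one, mul_one, ← h1]
    congr!
  · intro p hp q hq
    have : p ≠ q := fun h => hp (h ▸ hq)
    simp [keepRows, hp, this]

/-- Adding `x` to the diagonal entries in `W` expands a principal minor into smaller ones. -/
theorem minor_add_smul_diagonal (M : Matrix N N ℂ) {W T : Finset N} (hW : W ⊆ T) (x : ℂ) :
    minor (M + x • Matrix.diagonal fun p => if p ∈ W then 1 else 0) T
      = ∑ s ∈ W.powerset, x ^ (W \ s).card * minor M (T \ (W \ s)) := by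
  set m : N → N → ℂ := keepRows M T with hm
  set m' : N → N → ℂ := W.piecewise (fun p => x • fun q => if p = q then 1 else 0) m with hm'
  have h1 : keepRows (M + x • Matrix.diagonal fun p => if p ∈ W then 1 else 0) T
      = W.piecewise (m + m') m' := by
    ext p q
    by_cases hp : p ∈ W
    · simp [hm', hm, keepRows, hp, hW hp, Matrix.diagonal_apply, Finset.piecewise]
    · by_cases hpT : p ∈ T <;>
        simp [hm', hm, keepRows, hp, hpT, Matrix.diagonal_apply, Finset.piecewise]
  have h2 : minor (M + x • Matrix.diagonal fun p => if p ∈ W then 1 else 0) T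
      = Matrix.detRowAlternating.toMultilinearMap (W.piecewise (m + m') m') := by
    unfold minor
    rw [h1]
    rfl
  rw [h2, MultilinearMap.map_piecewise_add]
  refine Finset.sum_congr rfl fun s hs => ?_
  rw [Finset.mem_powerset] at hs
  have h3 : s.piecewise m m' = (W \ s).piecewise
      (fun p => x • keepRows M (T \ (W \ s)) p) (keepRows M (T \ (W \ s))) := by
    ext p q
    by_cases hps : p ∈ s
    · have := hs hps
      simp [hm, keepRows, hps, Finset.piecewise]
    · by_cases hpW : p ∈ W
      · simp [hm', keepRows, hps, hpW, Finset.piecewise]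
      · simp [hm', hm, keepRows, hps, hpW, Finset.piecewise]
  rw [h3, MultilinearMap.map_piecewise_smul, Finset.prod_const, smul_eq_mul]
  rfl

theorem powerset_singleton_eq {α : Type*} [DecidableEq α] (a : α) :
    ({a} : Finset α).powerset = {∅, {a}} := by
  ext s
  simp [Finset.subset_singleton_iff]

theorem minor_sub_smul_single (M : Matrix N N ℂ) {p : N} {T : Finset N} (hp : p ∈ T) (x : ℂ) :
    minor (M - x • Matrix.diagonal fun q => if q = p then 1 else 0) T
      = minor M T - x * minor M (T.erase p) := by
  have h := minor_add_smul_diagonal M (Finset.singleton_subset_iff.2 hp) (-x)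
  simp only [Finset.mem_singleton] at h
  rw [sub_eq_add_neg, ← neg_smul, h, powerset_singleton_eq,
    Finset.sum_pair (Finset.singleton_ne_empty p).symm]
  simp [Finset.erase_eq]
  ring

theorem conj_minor {M : Matrix N N ℂ} (T : Finset N) :
    minor M.conjTranspose T = conj (minor M T) := by
  rw [minor_eq_det_submatrix, minor_eq_det_submatrix, ← Matrix.conjTranspose_submatrix,
    Matrix.det_conjTranspose]
  rfl

theorem minor_nonneg {M : Matrix N N ℂ} (hM : M.PosSemidef) (T : Finset N) :
    0 ≤ (minor M T).re := by
  rw [minor_eq_det_submatrix]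
  exact (Complex.le_def.1 (hM.submatrix _).det_nonneg).1

theorem minor_pos {M : Matrix N N ℂ} (hM : M.PosDef) (T : Finset N) :
    0 < (minor M T).re := by
  rw [minor_eq_det_submatrix]
  exact (Complex.lt_def.1 (hM.submatrix Subtype.val_injective).det_pos).1

/-- A vector in the kernel of `keepRows M T` is supported on `T`, and `M v` vanishes on `T`. -/
theorem exists_of_minor_eq_zero {M : Matrix N N ℂ} {T : Finset N} (h : minor M T = 0) :
    ∃ v : N → ℂ, v ≠ 0 ∧ (∀ p ∉ T, v p = 0) ∧ ∀ p, conj (v p) * (M.mulVec v) p = 0 := by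
  obtain ⟨v, hv, hMv⟩ := Matrix.exists_mulVec_eq_zero_iff.2 h
  have h1 : ∀ p ∉ T, v p = 0 := by
    intro p hp
    have := congrFun hMv p
    simpa [keepRows, hp, Matrix.mulVec, Matrix.one_apply, dotProduct] using this
  refine ⟨v, hv, h1, fun p => ?_⟩
  by_cases hp : p ∈ T
  · have := congrFun hMv p
    have e : (Matrix.of (keepRows M T)).mulVec v p = M.mulVec v p := by
      simp [keepRows, hp, Matrix.mulVec]
    rw [← e, this]
    simp
  · simp [h1 p hp]

end RowDet

section MinorSum
variable {ι κ : Type*} [Fintype ι] [DecidableEq ι] [Fintype κ] [DecidableEq κ]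

/-- The indices selected by the sets `T i`, one for each block `i`. -/
def blockSet (T : ι → Finset κ) : Finset (ι × κ) := Finset.univ.filter fun p => p.2 ∈ T p.1

/-- The matrix `Y - B`, where `Y` is diagonal with entry `y i` throughout the block `i`. -/
def pencil (B : Matrix (ι × κ) (ι × κ) ℂ) (y : ι → ℂ) : Matrix (ι × κ) (ι × κ) ℂ :=
  Matrix.diagonal (fun p => y p.1) - B

/-- The sum of the principal minors of `Y - B` that keep `n i` indices of each block `i`. -/
noncomputable def minorSum (B : Matrix (ι × κ) (ι × κ) ℂ) (n : ι → ℕ) (y : ι → ℂ) : ℂ :=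
  ∑ T ∈ Fintype.piFinset fun i => Finset.powersetCard (n i) (Finset.univ : Finset κ),
    minor (pencil B y) (blockSet T)

/-- The part of the sum `minorSum B n` with the set `V` selected in the block `i`. -/
noncomputable def partialSum (B : Matrix (ι × κ) (ι × κ) ℂ) (n : ι → ℕ) (i : ι) (V : Finset κ)
    (y : ι → ℂ) : ℂ :=
  ∑ T ∈ Fintype.piFinset (update (fun i => Finset.powersetCard (n i) (Finset.univ : Finset κ))
    i {∅}), minor (pencil B y) (blockSet (update T i V))

variable (B : Matrix (ι × κ) (ι × κ) ℂ) (n : ι → ℕ) (i : ι)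

theorem minorSum_update (a : ℕ) (y : ι → ℂ) : minorSum B (update n i a) y
    = ∑ V ∈ Finset.powersetCard a Finset.univ, partialSum B n i V y := by
  unfold minorSum partialSum
  rw [← Finset.sum_product']
  symm
  refine Finset.sum_bij' (fun x _ => update x.2 i x.1) (fun T _ => (T i, update T i ∅))
    ?_ ?_ ?_ ?_ ?_
  · rintro ⟨V, T⟩ h
    simp only [Finset.mem_product, Fintype.mem_piFinset] at h ⊢
    intro j
    by_cases hj : j = i
    · subst hj; simpa using h.1
    · simpa [hj] using h.2 j
  · intro T h
    simp only [Finset.mem_product, Fintype.mem_piFinset] at h ⊢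
    refine ⟨by simpa using h i, fun j => ?_⟩
    by_cases hj : j = i
    · subst hj; simp
    · simpa [hj] using h j
  · rintro ⟨V, T⟩ h
    simp only [Finset.mem_product, Fintype.mem_piFinset] at h
    have := h.2 i
    simp only [update_self, Finset.mem_singleton] at this
    simp [← this]
  · intro T h
    simp
  · rintro ⟨V, T⟩ h
    rfl

/-- The expansion of a partial sum in powers of the variable of its block. -/
theorem partialSum_update (V : Finset κ) (y : ι → ℂ) (x : ℂ) :
    partialSum B n i V (update y i x)
      = ∑ U ∈ V.powerset, x ^ (V.card - U.card) * partialSum B n i U (update y i 0) := by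
  unfold partialSum
  simp only [Finset.mul_sum]
  rw [Finset.sum_comm]
  refine Finset.sum_congr rfl fun T _ => ?_
  set W : Finset (ι × κ) := V.image (Prod.mk i)
  have hinj : Injective (Prod.mk i : κ → ι × κ) := Prod.mk_right_injective i
  have hWT : W ⊆ blockSet (update T i V) := by
    intro p hp
    obtain ⟨v, hv, rfl⟩ := Finset.mem_image.1 hp
    simpa [blockSet] using hv
  have h1 : minor (pencil B (update y i x)) (blockSet (update T i V))
      = minor (pencil B (update y i 0) + x • Matrix.diagonal fun p => if p ∈ W then 1 else 0)
        (blockSet (update T i V)) := by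
    apply minor_congr
    rintro ⟨j, v⟩ hp
    ext q
    by_cases hj : j = i
    · subst hj
      have hv : v ∈ V := by simpa [blockSet] using hp
      have hvW : (j, v) ∈ W := Finset.mem_image_of_mem _ hv
      by_cases hq : (j, v) = q
      · subst hq; simp [pencil, hvW]; ring
      · simp [pencil, hq]
    · have hvW : (j, v) ∉ W := by
        intro h
        obtain ⟨u, -, hu⟩ := Finset.mem_image.1 h
        exact hj (Prod.ext_iff.1 hu).1.symm
      by_cases hq : (j, v) = q
      · subst hq; simp [pencil, hvW, hj]
      · simp [pencil, hq]
  rw [h1, minor_add_smul_diagonal _ hWT, Finset.powerset_image,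
    Finset.sum_image (Finset.image_injective hinj).injOn]
  refine Finset.sum_congr rfl fun U hU => ?_
  rw [Finset.mem_powerset] at hU
  rw [← Finset.image_sdiff _ _ hinj, Finset.card_image_of_injective _ hinj,
    Finset.card_sdiff_of_subset hU]
  congr 2
  ext ⟨j, v⟩
  by_cases hj : j = i
  · subst hj
    simp only [blockSet, Finset.mem_sdiff, Finset.mem_filter, Finset.mem_univ, true_and,
      update_self, Finset.mem_image, Prod.mk.injEq, exists_eq_right]
    constructor
    · rintro ⟨h, h'⟩
      by_contra hU'
      exact h' ⟨h, hU'⟩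
    · intro h
      exact ⟨hU h, fun h' => h'.2 h⟩
  · simp [blockSet, hj, Ne.symm hj]

theorem sum_powersetCard_pred {k : ℕ} (hk : Fintype.card κ = k) (h1 : 1 ≤ k)
    (f : Finset κ → ℂ) :
    ∑ V ∈ Finset.powersetCard (k - 1) (Finset.univ : Finset κ), f V = ∑ s : κ, f {s}ᶜ := by
  symm
  refine Finset.sum_bij (fun s _ => {s}ᶜ) ?_ ?_ ?_ ?_
  · intro s _
    simp [Finset.mem_powersetCard, Finset.card_compl, hk]
  · intro s _ s' _ h
    simpa using h
  · intro V hV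
    have hc : Vᶜ.card = 1 := by
      rw [Finset.card_compl, (Finset.mem_powersetCard.1 hV).2, hk]
      omega
    obtain ⟨s, hs⟩ := Finset.card_eq_one.1 hc
    exact ⟨s, Finset.mem_univ s, by rw [← hs, compl_compl]⟩
  · intro s _
    rfl

theorem minorSum_slice {k : ℕ} (hk : Fintype.card κ = k) (h1 : 2 ≤ k) (y : ι → ℂ) (hi : n i = k) :
    ∃ r : ℂ[X], r.natDegree ≤ k ∧ ∀ x,
    minorSum B n (update y i x) = r.eval x ∧
    minorSum B (update n i (k - 1)) (update y i x) = r.derivative.eval x ∧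
    minorSum B (update n i 1) (update y i x) = k * x * r.coeff k + r.coeff (k - 1) ∧
    minorSum B (update n i 0) (update y i x) = r.coeff k := by
  set e : Finset κ → ℂ := fun U => partialSum B n i U (update y i 0) with he
  have hU : ∀ U : Finset κ, U.card ≤ k := fun U => hk ▸ U.card_le_univ
  set r : ℂ[X] := ∑ U : Finset κ, C (e U) * X ^ (k - U.card) with hr
  have hcoef : ∀ l, r.coeff l = ∑ U : Finset κ, if l = k - U.card then e U else 0 := by
    intro l
    simp [hr, finsetSum_coeff, coeff_X_pow]
  have hck : r.coeff k = e ∅ := by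
    rw [hcoef, Finset.sum_eq_single ∅]
    · simp
    · intro U _ hne
      have := Finset.card_pos.2 (Finset.nonempty_iff_ne_empty.2 hne)
      rw [if_neg (by omega)]
    · simp
  have hck1 : r.coeff (k - 1) = ∑ s : κ, e {s} := by
    rw [hcoef, ← Finset.sum_filter]
    have : (Finset.univ.filter fun U : Finset κ => k - 1 = k - U.card)
        = Finset.powersetCard 1 Finset.univ := by
      ext U
      have := hU U
      simp only [Finset.mem_filter, Finset.mem_univ, true_and, Finset.mem_powersetCard,
        Finset.subset_univ]
      omega
    rw [this, Finset.powersetCard_one, Finset.sum_map]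
    rfl
  refine ⟨r, ?_, fun x => ⟨?_, ?_, ?_, ?_⟩⟩
  · refine natDegree_sum_le_of_forall_le _ _ fun U _ => ?_
    exact (natDegree_C_mul_X_pow_le _ _).trans (Nat.sub_le _ _)
  · conv_lhs => rw [← update_eq_self i n, hi]
    rw [minorSum_update, ← hk, ← Finset.card_univ, Finset.powersetCard_self,
      Finset.sum_singleton, partialSum_update, Finset.powerset_univ, Finset.card_univ, hk, hr,
      eval_finsetSum]
    exact Finset.sum_congr rfl fun U _ => by simp [he]; ring
  · rw [minorSum_update, sum_powersetCard_pred hk (by omega)]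
    rw [Finset.sum_congr rfl fun s _ => partialSum_update B n i {s}ᶜ y x]
    rw [hr, derivative_sum, eval_finsetSum]
    have h2 : ∀ s : κ, ∑ U ∈ ({s}ᶜ : Finset κ).powerset,
        x ^ (({s}ᶜ : Finset κ).card - U.card) * partialSum B n i U (update y i 0)
        = ∑ U : Finset κ, if s ∉ U then x ^ (k - 1 - U.card) * e U else 0 := by
      intro s
      rw [← Finset.sum_filter]
      refine Finset.sum_congr ?_ fun U _ => ?_
      · ext U
        simp only [Finset.mem_powerset, Finset.mem_filter, Finset.mem_univ, true_and]
        rw [Finset.subset_compl_comm, Finset.singleton_subset_iff, Finset.mem_compl]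
      · rw [Finset.card_compl, Finset.card_singleton, hk]
    simp only [h2]
    rw [Finset.sum_comm]
    refine Finset.sum_congr rfl fun U _ => ?_
    rw [← Finset.sum_filter, Finset.sum_const, nsmul_eq_mul]
    have h3 : (Finset.univ.filter fun s => s ∉ U).card = k - U.card := by
      have : (Finset.univ.filter fun s => s ∉ U) = Uᶜ := by ext; simp
      rw [this, Finset.card_compl, hk]
    rw [h3, show k - 1 - U.card = k - U.card - 1 by omega]
    simp [derivative_X_pow]
    ring
  · rw [minorSum_update, Finset.powersetCard_one, Finset.sum_map, hck, hck1]
    have h2 : ∀ s : κ, partialSum B n i {s} (update y i x) = x * e ∅ + e {s} := by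
      intro s
      rw [partialSum_update, powerset_singleton_eq,
        Finset.sum_pair (Finset.singleton_ne_empty s).symm]
      simp [he]
    change ∑ s : κ, partialSum B n i {s} (update y i x) = _
    simp only [h2]
    rw [Finset.sum_add_distrib, Finset.sum_const, Finset.card_univ, hk, nsmul_eq_mul]
    ring
  · rw [minorSum_update, Finset.powersetCard_zero, Finset.sum_singleton, partialSum_update,
      hck]
    simp [he]

theorem minorSum_sliceFamily {k : ℕ} (hk : Fintype.card κ = k) (h1 : 2 ≤ k)
    (hB : B.IsHermitian) : SliceFamily k (minorSum B) where
  continuous n := by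
    refine continuous_finsetSum _ fun T _ => Continuous.matrix_det ?_
    refine continuous_matrix fun p q => ?_
    by_cases hp : p ∈ blockSet T
    · simp only [keepRows, hp, pencil, Matrix.of_apply, if_true, Matrix.sub_apply]
      by_cases hpq : p = q
      · subst hpq
        simp only [Matrix.diagonal_apply_eq]
        fun_prop
      · simp only [Matrix.diagonal_apply_ne _ hpq]
        fun_prop
    · simp only [keepRows, hp, Matrix.of_apply, if_false]
      fun_prop
  conj_apply n y := by
    unfold minorSum
    rw [map_sum]
    refine Finset.sum_congr rfl fun T _ => ?_
    rw [← conj_minor]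
    congr 1
    unfold pencil
    rw [Matrix.conjTranspose_sub, hB.eq, Matrix.diagonal_conjTranspose]
    rfl
  slice n i y hi := minorSum_slice B n i hk h1 y hi

end MinorSum

/-! ### Unprocessed blocks: positive semidefinite matrices -/

open Matrix

section PosSemidef
variable {N : Type*} [Fintype N]

theorem re_star_dotProduct_nonneg {B : Matrix N N ℂ} (hB : B.PosSemidef) (v : N → ℂ) :
    0 ≤ (star v ⬝ᵥ B *ᵥ v).re := (Complex.le_def.1 (hB.dotProduct_mulVec_nonneg v)).1

theorem star_dotProduct_self (v : N → ℂ) : star v ⬝ᵥ v = ((∑ p, ‖v p‖ ^ 2 : ℝ) : ℂ) := by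
  simp only [dotProduct, Pi.star_apply]
  push_cast
  refine Finset.sum_congr rfl fun p _ => ?_
  exact Complex.conj_mul' (v p)

theorem star_dotProduct_mulVec_comm {B : Matrix N N ℂ} (hB : B.IsHermitian) (u v : N → ℂ) :
    star u ⬝ᵥ B *ᵥ v = conj (star v ⬝ᵥ B *ᵥ u) := by
  change _ = star (star v ⬝ᵥ B *ᵥ u)
  rw [← star_dotProduct, star_mulVec, hB.eq, dotProduct_mulVec]

variable [DecidableEq N]

/-- The Cauchy-Schwarz inequality for the form of `B`, applied to a basis vector and `v`. -/
theorem norm_mulVec_apply_sq_le {B : Matrix N N ℂ} (hB : B.PosSemidef) (p : N) (v : N → ℂ) :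
    ‖(B *ᵥ v) p‖ ^ 2 ≤ (B p p).re * (star v ⬝ᵥ B *ᵥ v).re := by
  set W : Matrix N (Fin 2) ℂ := Matrix.of fun q => ![(Pi.single p 1 : N → ℂ) q, v q] with hW
  have hps := hB.conjTranspose_mul_mul_same W
  have hent : ∀ b c, (Wᴴ * B * W) b c = star (fun q => W q b) ⬝ᵥ B *ᵥ fun q => W q c := by
    intro b c
    rw [Matrix.mul_assoc, Matrix.mul_apply]
    rfl
  have e0 : (fun q => W q 0) = Pi.single p 1 := by ext q; simp [hW]
  have e1 : (fun q => W q 1) = v := by ext q; simp [hW]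
  have hdet := hps.det_nonneg
  rw [Matrix.det_fin_two, hent, hent, hent, hent, e0, e1,
    star_dotProduct_mulVec_comm hB.isHermitian v (Pi.single p 1)] at hdet
  have es : star (Pi.single p 1 : N → ℂ) = Pi.single p 1 := by
    ext q
    by_cases h : q = p
    · subst h; simp
    · simp [h]
  have ep : (B *ᵥ Pi.single p 1) p = B p p := by simp
  rw [es, single_one_dotProduct, single_one_dotProduct, ep, Complex.mul_conj,
    Complex.normSq_eq_norm_sq] at hdet
  have h1 := (Complex.le_def.1 hdet).1
  have him : (star v ⬝ᵥ B *ᵥ v).im = 0 :=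
    ((Complex.le_def.1 (hB.dotProduct_mulVec_nonneg v)).2).symm
  rw [Complex.zero_re, Complex.sub_re, Complex.mul_re, him, mul_zero, sub_zero,
    Complex.ofReal_re] at h1
  linarith

/-- For `0 ≤ B ≤ 1` the diagonal entry at `p` of the inverse of `t - B` is at most
`1 / t + B p p / (t (t - 1))`, stated without the inverse. It follows from the decomposition
`v p = ((1 - B) v) p + (B v) p` and the Cauchy-Schwarz inequality for `1 - B` and `B`. -/
theorem norm_apply_sq_le {B : Matrix N N ℂ} (hB : B.PosSemidef) (hB1 : (1 - B).PosSemidef)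
    {t : ℝ} (ht : 1 < t) (p : N) (v : N → ℂ) :
    ‖v p‖ ^ 2 ≤ (1 / t + (B p p).re / (t * (t - 1))) *
      (t * ∑ q, ‖v q‖ ^ 2 - (star v ⬝ᵥ B *ᵥ v).re) := by
  have h1 := norm_mulVec_apply_sq_le hB p v
  have h2 := norm_mulVec_apply_sq_le hB1 p v
  have hQ2 := re_star_dotProduct_nonneg hB v
  have hQ1 := re_star_dotProduct_nonneg hB1 v
  have ha : 0 ≤ (B p p).re := (Complex.le_def.1 hB.diag_nonneg).1
  have ha1 : 0 ≤ ((1 - B) p p).re := (Complex.le_def.1 hB1.diag_nonneg).1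
  have hs : (∑ q, ‖v q‖ ^ 2) = (star v ⬝ᵥ (1 - B) *ᵥ v).re + (star v ⬝ᵥ B *ᵥ v).re := by
    rw [← Complex.add_re, ← dotProduct_add, ← add_mulVec, sub_add_cancel, one_mulVec,
      star_dotProduct_self, Complex.ofReal_re]
  have hv : ‖v p‖ ≤ ‖((1 - B) *ᵥ v) p‖ + ‖(B *ᵥ v) p‖ := by
    have : v p = ((1 - B) *ᵥ v) p + (B *ᵥ v) p := by
      rw [← Pi.add_apply, ← add_mulVec, sub_add_cancel, one_mulVec]
    conv_lhs => rw [this]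
    exact norm_add_le _ _
  rw [Matrix.sub_apply, Matrix.one_apply_eq, Complex.sub_re, Complex.one_re] at ha1 h2
  rw [hs]
  generalize (star v ⬝ᵥ (1 - B) *ᵥ v).re = Q1 at *
  generalize (star v ⬝ᵥ B *ᵥ v).re = Q2 at *
  generalize ‖((1 - B) *ᵥ v) p‖ = α at *
  generalize ‖(B *ᵥ v) p‖ = β at *
  generalize (B p p).re = a at *
  have hv0 := norm_nonneg (v p)
  have ht0 : 0 < t := by linarith
  have ht1 : 0 < t - 1 := by linarith
  have hsq : ‖v p‖ ^ 2 ≤ (α + β) ^ 2 := pow_le_pow_left₀ hv0 hv 2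
  set Xx := (1 - a) * Q2 * ((t - 1) / t) with hX
  set Yy := a * Q1 * (t / (t - 1)) with hY
  have hX0 : 0 ≤ Xx := by positivity
  have hY0 : 0 ≤ Yy := by positivity
  have hXY : (α * β) ^ 2 ≤ Xx * Yy := by
    have : Xx * Yy = ((1 - a) * Q1) * (a * Q2) := by
      rw [hX, hY]
      field_simp
    rw [this, mul_pow]
    exact mul_le_mul h2 h1 (sq_nonneg _) (by positivity)
  have h3 : 2 * (α * β) ≤ Xx + Yy := by
    apply le_of_sq_le_sq _ (by positivity)
    nlinarith [sq_nonneg (Xx - Yy)]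
  have h4 : (1 / t + a / (t * (t - 1))) * (t * (Q1 + Q2) - Q2)
      = (1 - a) * Q1 + a * Q2 + Xx + Yy := by
    rw [hX, hY]
    field_simp
    ring
  rw [h4]
  nlinarith

/-- The largest multiple of the matrix unit at `(p, p)` that the estimate `norm_apply_sq_le` allows
to be subtracted from `D - B`, for a diagonal matrix `D ≥ t`. -/
theorem posSemidef_sub_single {B : Matrix N N ℂ} (hB : B.PosSemidef) (hB1 : (1 - B).PosSemidef)
    {t : ℝ} (ht : 1 < t) {p : N} {τ : ℝ}
    (hτ : τ * (1 / t + (B p p).re / (t * (t - 1))) = 1) {d : N → ℝ} (hd : ∀ q, t ≤ d q) :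
    (diagonal (fun q => (d q : ℂ)) - B
      - (τ : ℂ) • diagonal fun q => if q = p then 1 else 0).PosSemidef := by
  have ha : 0 ≤ (B p p).re := (Complex.le_def.1 hB.diag_nonneg).1
  have ht1 : 0 < t - 1 := by linarith
  have hφ : 0 < 1 / t + (B p p).re / (t * (t - 1)) := by positivity
  have hτ0 : 0 ≤ τ := by
    by_contra! h
    nlinarith
  have hher : (diagonal (fun q => (d q : ℂ)) - B
      - (τ : ℂ) • diagonal fun q => if q = p then 1 else 0).IsHermitian := by
    refine (IsHermitian.sub ?_ hB.isHermitian).sub ?_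
    · exact isHermitian_diagonal_of_self_adjoint _ (funext fun q => by simp)
    · ext q r
      by_cases h : q = r
      · subst h; by_cases hq : q = p <;> simp [hq]
      · simp [h, Ne.symm h]
  refine PosSemidef.of_dotProduct_mulVec_nonneg hher fun v => ?_
  have him : (star v ⬝ᵥ B *ᵥ v).im = 0 :=
    ((Complex.le_def.1 (hB.dotProduct_mulVec_nonneg v)).2).symm
  have e1 : ∀ f : N → ℝ, star v ⬝ᵥ (diagonal (fun q => (f q : ℂ))) *ᵥ v
      = ((∑ q, f q * ‖v q‖ ^ 2 : ℝ) : ℂ) := by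
    intro f
    simp only [dotProduct, mulVec_diagonal, Pi.star_apply]
    push_cast
    refine Finset.sum_congr rfl fun q _ => ?_
    rw [← Complex.conj_mul' (v q)]
    change conj (v q) * _ = _
    ring
  have e2 : star v ⬝ᵥ (diagonal fun q => if q = p then (1 : ℂ) else 0) *ᵥ v
      = ((‖v p‖ ^ 2 : ℝ) : ℂ) := by
    have := e1 fun q => if q = p then 1 else 0
    simp only [apply_ite Complex.ofReal, Complex.ofReal_one, Complex.ofReal_zero] at this
    rw [this]
    simp
  have h := norm_apply_sq_le hB hB1 ht p v
  rw [sub_mulVec, sub_mulVec, dotProduct_sub, dotProduct_sub, smul_mulVec, dotProduct_smul, e1,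
    e2, smul_eq_mul, ← Complex.ofReal_mul, Complex.le_def]
  refine ⟨?_, by
    rw [Complex.sub_im, Complex.sub_im, Complex.ofReal_im, Complex.ofReal_im, him]
    simp⟩
  rw [Complex.sub_re, Complex.sub_re, Complex.ofReal_re, Complex.ofReal_re, Complex.zero_re]
  have h5 : t * ∑ q, ‖v q‖ ^ 2 ≤ ∑ q, d q * ‖v q‖ ^ 2 := by
    rw [Finset.mul_sum]
    exact Finset.sum_le_sum fun q _ => mul_le_mul_of_nonneg_right (hd q) (sq_nonneg _)
  have h6 := mul_le_mul_of_nonneg_left h hτ0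
  rw [← mul_assoc, hτ, one_mul] at h6
  linarith

end PosSemidef

section Base
variable {ι κ : Type*} [Fintype ι] [DecidableEq ι] [Fintype κ] [DecidableEq κ]
  {B : Matrix (ι × κ) (ι × κ) ℂ} {k : ℕ} {n : ι → ℕ}

theorem minorSum_of_unprocessed (hk : Fintype.card κ = k) (hn : ∀ i, n i = 0 ∨ n i = k)
    (y : ι → ℂ) : minorSum B n y
      = minor (pencil B y) (blockSet fun i => if n i = k then Finset.univ else ∅) := by
  unfold minorSum
  have : (fun i => Finset.powersetCard (n i) (Finset.univ : Finset κ))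
      = fun i => {if n i = k then Finset.univ else ∅} := by
    ext1 i
    by_cases h : n i = k
    · rw [if_pos h, h, ← hk, ← Finset.card_univ, Finset.powersetCard_self]
    · rw [if_neg h, (hn i).resolve_right h, Finset.powersetCard_zero]
  rw [this, Fintype.piFinset_singleton, Finset.sum_singleton]

theorem pencil_mulVec (y : ι → ℂ) (v : ι × κ → ℂ) (p : ι × κ) :
    (pencil B y *ᵥ v) p = y p.1 * v p - (B *ᵥ v) p := by
  simp [pencil, sub_mulVec, mulVec_diagonal]

theorem stable_minorSum_of_unprocessed (hk : Fintype.card κ = k) (hB : B.PosSemidef)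
    (hn : ∀ i, n i = 0 ∨ n i = k) : Stable (minorSum B n) := by
  intro y hy h0
  rw [minorSum_of_unprocessed hk hn] at h0
  obtain ⟨v, hv, -, hp⟩ := exists_of_minor_eq_zero h0
  have him : (star v ⬝ᵥ B *ᵥ v).im = 0 :=
    ((Complex.le_def.1 (hB.dotProduct_mulVec_nonneg v)).2).symm
  have h1 : ∀ p, conj (v p) * (B *ᵥ v) p = y p.1 * ((‖v p‖ ^ 2 : ℝ) : ℂ) := by
    intro p
    have := hp p
    rw [pencil_mulVec] at this
    push_cast
    rw [← Complex.conj_mul']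
    linear_combination -this
  have h2 : ∑ p, (y p.1).im * ‖v p‖ ^ 2 = 0 := by
    rw [← him]
    simp only [dotProduct, Pi.star_apply, Complex.im_sum]
    refine Finset.sum_congr rfl fun p _ => ?_
    change _ = (conj (v p) * _).im
    rw [h1, mul_comm, ← Complex.im_ofReal_mul, mul_comm]
  rw [Finset.sum_eq_zero_iff_of_nonneg fun p _ => mul_nonneg (hy p.1).le (sq_nonneg _)] at h2
  refine hv (funext fun p => ?_)
  have := h2 p (Finset.mem_univ p)
  simpa [(hy p.1).ne'] using this

theorem posDef_pencil {ι κ : Type*} [DecidableEq ι] [DecidableEq κ]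
    {B : Matrix (ι × κ) (ι × κ) ℂ} (hB1 : (1 - B).PosSemidef) {y : ι → ℝ} (hy : ∀ i, 1 < y i) :
    (pencil B fun i => (y i : ℂ)).PosDef := by
  have : pencil B (fun i => (y i : ℂ))
      = diagonal (fun p : ι × κ => ((y p.1 - 1 : ℝ) : ℂ)) + (1 - B) := by
    ext p q
    by_cases h : p = q
    · subst h; simp [pencil]
    · simp [pencil, h]
  rw [this]
  refine PosDef.add_posSemidef (PosDef.diagonal fun p => ?_) hB1
  have := hy p.1
  exact Complex.zero_lt_real.2 (by linarith)

/-- The slices of the unprocessed minors have no negative zeros: a kernel vector, split into its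
part `a` in the block `j` and the rest `b`, would satisfy
`x |a|² - ⟨a, B a⟩ = ∑ y |b|² - ⟨b, B b⟩` with a left side `≤ 0` and a right side `≥ 0`. -/
theorem minor_pencil_update_ne_zero (hB : B.PosSemidef) (hB1 : (1 - B).PosSemidef)
    {y : ι → ℝ} {j : ι} (hy : ∀ i, i ≠ j → 1 < y i) {x : ℝ} (hx : x < 0)
    (T : Finset (ι × κ)) :
    minor (pencil B fun i => ((update y j x i : ℝ) : ℂ)) T ≠ 0 := by
  intro h0
  obtain ⟨v, hv, -, hp⟩ := exists_of_minor_eq_zero h0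
  set a : ι × κ → ℂ := fun p => if p.1 = j then v p else 0 with ha
  set b : ι × κ → ℂ := fun p => if p.1 = j then 0 else v p with hb
  have hab : v = a + b := by
    ext p
    by_cases h : p.1 = j <;> simp [ha, hb, h]
  have h1 : star (a - b) ⬝ᵥ (B *ᵥ v)
      = ((x * ∑ p, ‖a p‖ ^ 2 - ∑ p, y p.1 * ‖b p‖ ^ 2 : ℝ) : ℂ) := by
    rw [Finset.mul_sum, ← Finset.sum_sub_distrib, Complex.ofReal_sum]
    refine Finset.sum_congr rfl fun p _ => ?_
    have h2 := hp p
    rw [pencil_mulVec] at h2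
    by_cases h : p.1 = j
    · simp only [h, update_self] at h2
      have h3 := Complex.conj_mul' (v p)
      simp [ha, hb, h]
      linear_combination x * h3 - h2
    · simp only [update_of_ne h] at h2
      have h3 := Complex.conj_mul' (v p)
      simp [ha, hb, h]
      linear_combination (y p.1) * h3 - h2
  have h2 := congrArg Complex.re h1
  have hcross := congrArg Complex.re (star_dotProduct_mulVec_comm hB.isHermitian a b)
  rw [Complex.conj_re] at hcross
  rw [hab, mulVec_add, star_sub, sub_dotProduct, dotProduct_add, dotProduct_add, Complex.ofReal_re,
    Complex.sub_re, Complex.add_re, Complex.add_re, hcross] at h2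
  have ha0 := re_star_dotProduct_nonneg hB a
  have hb0 := re_star_dotProduct_nonneg hB1 b
  rw [sub_mulVec, one_mulVec, dotProduct_sub, star_dotProduct_self, Complex.sub_re,
    Complex.ofReal_re] at hb0
  have hsum : ∑ p, (-x * ‖a p‖ ^ 2 + (y p.1 - 1) * ‖b p‖ ^ 2) ≤ 0 := by
    simp only [Finset.sum_add_distrib, ← Finset.mul_sum, sub_mul, one_mul,
      Finset.sum_sub_distrib]
    linarith
  have hterm : ∀ p, 0 ≤ -x * ‖a p‖ ^ 2 + (y p.1 - 1) * ‖b p‖ ^ 2 := by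
    intro p
    by_cases h : p.1 = j
    · have : 0 < -x := by linarith
      simp [hb, h]
      nlinarith [sq_nonneg ‖a p‖]
    · have := hy _ h
      have h3 : 0 ≤ (y p.1 - 1) * ‖b p‖ ^ 2 := mul_nonneg (by linarith) (sq_nonneg _)
      simpa [ha, h] using h3
  have hz := (Finset.sum_eq_zero_iff_of_nonneg fun p _ => hterm p).1
    (le_antisymm hsum (Finset.sum_nonneg fun p _ => hterm p))
  refine hv (funext fun p => ?_)
  have h3 := hz p (Finset.mem_univ p)
  by_cases h : p.1 = j
  · simpa [ha, hb, h, hx.ne] using h3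
  · have := hy _ h
    have h4 : y p.1 - 1 ≠ 0 := by linarith
    simpa [ha, hb, h, h4] using h3

theorem erase_blockSet (T : ι → Finset κ) (j : ι) (hj : T j = Finset.univ) (s : κ) :
    blockSet (update T j {s}ᶜ) = (blockSet T).erase (j, s) := by
  ext ⟨i, u⟩
  by_cases h : i = j
  · subst h; simp [blockSet, hj]
  · simp [blockSet, h]

/-- The barrier before any processing. The bound on the logarithmic derivative is the sum over the
block `j` of the bounds on the ratios of the minors without and with the index `(j, s)`; these
ratios are the diagonal entries of an inverse matrix. -/
theorem barrier_minorSum_of_unprocessed (hk : Fintype.card κ = k) (hk2 : 2 ≤ k)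
    (hB : B.PosSemidef) (hB1 : (1 - B).PosSemidef) {ε t δ φ : ℝ} (ht : 1 < t)
    (hε : ∀ i, ∑ s : κ, (B (i, s) (i, s)).re ≤ ε) (hφ : φ = k / t + ε / (t * (t - 1)))
    (hn : ∀ i, n i = 0 ∨ n i = k) : Barrier (minorSum B) k t δ φ n := by
  have hn1 : ∀ i, n i ≠ 1 := fun i => by rcases hn i with h | h <;> omega
  have ht1 : 0 < t - 1 := by linarith
  refine ⟨?_, ?_, ?_⟩
  · intro y hy
    unfold onReal
    rw [minorSum_of_unprocessed hk hn]
    refine minor_pos (posDef_pencil hB1 fun i => ?_) _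
    have := hy i
    rw [base_of_ne_one (hn1 i)] at this
    linarith
  · intro j hj y hy
    have hyt : ∀ i, t ≤ y i := fun i => by
      have := hy i
      rwa [base_of_ne_one (hn1 i)] at this
    set T : ι → Finset κ := fun i => if n i = k then Finset.univ else ∅ with hT
    have hTj : T j = Finset.univ := by simp [hT, hj]
    set M := pencil B fun i => (y i : ℂ) with hM
    have hpos : 0 < (minor M (blockSet T)).re :=
      minor_pos (posDef_pencil hB1 fun i => ht.trans_le (hyt i)) _
    have h1 : minorSum B (update n j (k - 1)) (fun i => (y i : ℂ))
        = ∑ s : κ, minor M ((blockSet T).erase (j, s)) := by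
      have e : update (fun i => Finset.powersetCard (n i) (Finset.univ : Finset κ)) j {∅}
          = fun i => {update T j ∅ i} := by
        ext1 i
        by_cases h : i = j
        · subst h; simp
        · rw [update_of_ne h, update_of_ne h]
          by_cases h' : n i = k
          · rw [h', ← hk, ← Finset.card_univ, Finset.powersetCard_self]
            simp [hT, h']
          · rw [(hn i).resolve_right h', Finset.powersetCard_zero]
            simp [hT, h']
      rw [minorSum_update, sum_powersetCard_pred hk (by omega)]
      refine Finset.sum_congr rfl fun s _ => ?_
      unfold partialSum
      rw [e, Fintype.piFinset_singleton, Finset.sum_singleton, update_idem,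
        erase_blockSet T j hTj s]
    have h2 : ∀ s : κ, (minor M ((blockSet T).erase (j, s))).re
        ≤ (1 / t + (B (j, s) (j, s)).re / (t * (t - 1))) * (minor M (blockSet T)).re := by
      intro s
      have hmem : (j, s) ∈ blockSet T := by simp [blockSet, hTj]
      have ha : 0 ≤ (B (j, s) (j, s)).re := (Complex.le_def.1 hB.diag_nonneg).1
      set c := 1 / t + (B (j, s) (j, s)).re / (t * (t - 1)) with hc
      have hc0 : 0 < c := by positivity
      have h3 := minor_nonneg (posSemidef_sub_single hB hB1 ht (p := (j, s)) (τ := 1 / c)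
        (by rw [← hc]; field_simp) (d := fun p => y p.1) fun p => hyt p.1) (blockSet T)
      change 0 ≤ (minor (M - _) _).re at h3
      rw [minor_sub_smul_single _ hmem, Complex.sub_re, Complex.re_ofReal_mul] at h3
      have : 1 / c * (minor M ((blockSet T).erase (j, s))).re ≤ (minor M (blockSet T)).re := by
        linarith
      rwa [one_div, inv_mul_le_iff₀ hc0] at this
    unfold onReal
    rw [h1, minorSum_of_unprocessed hk hn, Complex.re_sum]
    refine (Finset.sum_le_sum fun s _ => h2 s).trans ?_
    rw [← Finset.sum_mul]
    refine mul_le_mul_of_nonneg_right ?_ hpos.le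
    rw [Finset.sum_add_distrib, Finset.sum_const, Finset.card_univ, hk, ← Finset.sum_div, hφ,
      nsmul_eq_mul, mul_one_div]
    have := hε j
    gcongr
  · intro j hj y hy x hx
    have h1 : minorSum B n (fun i => ((update y j x i : ℝ) : ℂ)) ≠ 0 := by
      rw [minorSum_of_unprocessed hk hn]
      refine minor_pencil_update_ne_zero hB hB1 (fun i hi => ?_) hx _
      have := hy i hi
      rw [base_of_ne_one (hn1 i)] at this
      linarith
    rw [(minorSum_sliceFamily B hk hk2 hB.isHermitian).apply_ofReal] at h1
    exact_mod_cast h1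

end Base

/-! ### The characteristic polynomial as a sum of minors, and the optimization -/

section Reindex
variable {k m : ℕ}

/-- The blocks of positions: `(i, j)` stands for `pos j i`. -/
def blockEquiv (k m : ℕ) : Fin m × Fin k ≃ Fin (k * m) :=
  (Equiv.prodComm _ _).trans finProdFinEquiv

theorem mem_kPartitions_iff {S : Fin k → Finset (Fin m)} :
    S ∈ kPartitions k m ↔ ∀ i, (Finset.univ.filter fun j => i ∈ S j).card = 1 := by
  simp only [kPartitions, Finset.mem_filter, Finset.mem_univ, true_and, Finset.card_eq_one]
  constructor
  · rintro ⟨hd, hu⟩ i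
    have : i ∈ Finset.univ.biUnion S := hu ▸ Finset.mem_univ i
    obtain ⟨j, -, hj⟩ := Finset.mem_biUnion.1 this
    refine ⟨j, ?_⟩
    ext l
    simp only [Finset.mem_filter, Finset.mem_univ, true_and, Finset.mem_singleton]
    constructor
    · intro hl
      by_contra hne
      exact Finset.disjoint_left.1 (hd l j hne) hl hj
    · rintro rfl
      exact hj
  · intro h
    refine ⟨fun a b hab => Finset.disjoint_left.2 fun i ha hb => hab ?_, ?_⟩
    · obtain ⟨j, hj⟩ := h i
      have h1 : a ∈ ({j} : Finset (Fin k)) := hj ▸ by simpa using ha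
      have h2 : b ∈ ({j} : Finset (Fin k)) := hj ▸ by simpa using hb
      rw [Finset.mem_singleton.1 h1, Finset.mem_singleton.1 h2]
    · ext i
      obtain ⟨j, hj⟩ := h i
      have h1 : j ∈ Finset.univ.filter fun j => i ∈ S j := hj ▸ Finset.mem_singleton_self j
      simp only [Finset.mem_biUnion, Finset.mem_univ, true_and, iff_true]
      exact ⟨j, by simpa using h1⟩

theorem blockEquiv_mem_blockUnion_iff (S : Fin k → Finset (Fin m)) (p : Fin m × Fin k) :
    p ∈ blockSet (fun i => Finset.univ.filter fun j => i ∈ S j) ↔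
      blockEquiv k m p ∈ blockUnion S := by
  have h : ∀ j i, pos j i = blockEquiv k m p ↔ (i, j) = p := fun j i =>
    (blockEquiv k m).injective.eq_iff (a := (i, j))
  simp only [blockSet, blockUnion, Finset.mem_filter, Finset.mem_univ, true_and,
    Finset.mem_biUnion, Finset.mem_image, h]
  constructor
  · intro hp
    exact ⟨p.2, p.1, hp, rfl⟩
  · rintro ⟨j, i, hi, rfl⟩
    exact hi

theorem sum_kPartitions (f : (Fin m → Finset (Fin k)) → ℂ) :
    ∑ S ∈ kPartitions k m, f (fun i => Finset.univ.filter fun j => i ∈ S j)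
      = ∑ T ∈ Fintype.piFinset fun _ => Finset.powersetCard 1 Finset.univ, f T := by
  refine Finset.sum_bij' (fun S _ i => Finset.univ.filter fun j => i ∈ S j)
    (fun T _ j => Finset.univ.filter fun i => j ∈ T i) ?_ ?_ ?_ ?_ ?_
  · intro S hS
    rw [mem_kPartitions_iff] at hS
    simpa [Finset.mem_powersetCard] using hS
  · intro T hT
    rw [mem_kPartitions_iff]
    simpa [Finset.mem_powersetCard] using hT
  · intro S _
    ext j i
    simp
  · intro T _
    ext i j
    simp
  · intro S _
    rfl

theorem det_principal_blockUnion (A : Matrix (Fin (k * m)) (Fin (k * m)) ℂ) (x : ℂ)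
    (S : Fin k → Finset (Fin m)) :
    (principal (x • (1 : Matrix (Fin (k * m)) (Fin (k * m)) ℂ) - A) (blockUnion S)).det
      = minor (pencil (A.submatrix (blockEquiv k m) (blockEquiv k m)) fun _ => x)
        (blockSet fun i => Finset.univ.filter fun j => i ∈ S j) := by
  rw [minor_eq_det_submatrix, ← Matrix.det_submatrix_equiv_self
    ((blockEquiv k m).subtypeEquiv (blockEquiv_mem_blockUnion_iff S))]
  congr 1
  ext p q
  by_cases h : p = q
  · subst h; simp [principal, pencil]
  · have h' : (p : Fin m × Fin k) ≠ q := fun h0 => h (Subtype.ext h0)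
    simp [principal, pencil, h']

theorem eval_kmCharpoly (A : Matrix (Fin (k * m)) (Fin (k * m)) ℂ) (x : ℂ) :
    (kmCharpoly k m A).eval x = 1 / (k : ℂ) ^ m *
      minorSum (A.submatrix (blockEquiv k m) (blockEquiv k m)) (fun _ => 1) (fun _ => x) := by
  unfold kmCharpoly kmDet minorSum
  rw [eval_mul, eval_C, eval_finsetSum, ← sum_kPartitions]
  congr 1
  refine Finset.sum_congr rfl fun S _ => ?_
  rw [← det_principal_blockUnion, ← coe_evalRingHom, RingHom.map_det]
  congr 1
  ext p q
  by_cases h : p = q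
  · subst h; simp [principal]
  · have h' : (p : Fin (k * m)) ≠ q := fun h0 => h (Subtype.ext h0)
    simp [principal, h']

theorem card_blockUnion {S : Fin k → Finset (Fin m)} (hS : S ∈ kPartitions k m) :
    (blockUnion S).card = m := by
  simp only [kPartitions, Finset.mem_filter, Finset.mem_univ, true_and] at hS
  have hinj : ∀ j, Injective (pos j : Fin m → Fin (k * m)) := fun j a b h =>
    congrArg Prod.fst ((blockEquiv k m).injective (a₁ := (a, j)) (a₂ := (b, j)) h)
  unfold blockUnion
  rw [Finset.card_biUnion]
  · simp only [Finset.card_image_of_injective _ (hinj _)]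
    rw [← Finset.card_biUnion fun a _ b _ hab => hS.1 a b hab, hS.2, Finset.card_univ,
      Fintype.card_fin]
  · intro a _ b _ hab
    refine Finset.disjoint_left.2 ?_
    intro p ha hb
    obtain ⟨u, -, rfl⟩ := Finset.mem_image.1 ha
    obtain ⟨w, -, hw⟩ := Finset.mem_image.1 hb
    exact hab (congrArg Prod.snd
      ((blockEquiv k m).injective (a₁ := (w, b)) (a₂ := (u, a)) hw)).symm

theorem coeff_kmCharpoly_ne_zero (hk : 1 ≤ k) (A : Matrix (Fin (k * m)) (Fin (k * m)) ℂ) :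
    (kmCharpoly k m A).coeff m ≠ 0 := by
  have hne : (kPartitions k m).Nonempty := by
    refine ⟨fun j => if j = ⟨0, hk⟩ then Finset.univ else ∅, mem_kPartitions_iff.2 fun i => ?_⟩
    rw [Finset.card_eq_one]
    refine ⟨⟨0, hk⟩, ?_⟩
    ext j
    by_cases h : j = ⟨0, hk⟩ <;> simp [h]
  unfold kmCharpoly kmDet
  rw [coeff_C_mul, finsetSum_coeff]
  have h1 : ∀ S ∈ kPartitions k m, (principal ((X : ℂ[X]) •
      (1 : Matrix (Fin (k * m)) (Fin (k * m)) ℂ[X]) - A.map C) (blockUnion S)).det.coeff m = 1 := by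
    intro S hS
    have e : principal ((X : ℂ[X]) • (1 : Matrix (Fin (k * m)) (Fin (k * m)) ℂ[X]) - A.map C)
        (blockUnion S) = charmatrix (principal A (blockUnion S)) := by
      ext1 p q
      by_cases h : p = q
      · subst h; simp [principal]
      · have h' : (p : Fin (k * m)) ≠ q := fun h0 => h (Subtype.ext h0)
        simp [principal, h, h']
    rw [e]
    have hd := charpoly_natDegree_eq_dim (principal A (blockUnion S))
    rw [Fintype.card_coe, card_blockUnion hS] at hd
    have hm := charpoly_monic (principal A (blockUnion S))
    unfold Monic leadingCoeff at hm
    rwa [hd] at hm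
  rw [Finset.sum_congr rfl h1, Finset.sum_const, nsmul_eq_mul, mul_one]
  have hk0 : (k : ℂ) ≠ 0 := by exact_mod_cast (by omega : k ≠ 0)
  have hc : ((kPartitions k m).card : ℂ) ≠ 0 := by
    exact_mod_cast (Finset.card_pos.2 hne).ne'
  positivity

end Reindex

/-- The minimum over `t > 1` of the barrier bound, found at
`t = s₀ + 1 - ε / (k - 1)` with `s₀ = √(ε (1 - ε / (k - 1)))`. The hypothesis on `ε` says that this
`t` is at least `1`. As it may be equal to `1`, it is approached from the right. -/
theorem le_of_forall_barrier {k ε x : ℝ} (hk : 2 ≤ k) (hε0 : 0 ≤ ε) (hεk : ε ≤ (k - 1) ^ 2 / k)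
    (h : ∀ t δ : ℝ, 1 < t → k * δ = (k - 1) ^ 2 / (k / t + ε / (t * (t - 1)) - 1 / t) →
      x ≤ t - δ) :
    x ≤ 1 / k * (√(1 - ε / (k - 1)) + √ε) ^ 2 := by
  have hk0 : 0 < k := by linarith
  have hk1 : 0 < k - 1 := by linarith
  have hεk' : ε * k ≤ (k - 1) ^ 2 := (le_div_iff₀ hk0).1 hεk
  set P := 1 - ε / (k - 1) with hP
  have hPε : ε / (k - 1) ^ 2 ≤ P := by
    have : P - ε / (k - 1) ^ 2 = ((k - 1) ^ 2 - ε * k) / (k - 1) ^ 2 := by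
      rw [hP]
      field_simp
      ring
    have h2 : 0 ≤ ((k - 1) ^ 2 - ε * k) / (k - 1) ^ 2 :=
      div_nonneg (by linarith) (sq_nonneg _)
    linarith
  have hP0 : 0 ≤ P := (div_nonneg hε0 (sq_nonneg _)).trans hPε
  have key : ∀ s, ε / (k - 1) < s → k * x ≤ s + P + ε + P * ε / s := by
    intro s hs
    have hs0 : 0 < s := (div_nonneg hε0 hk1.le).trans_lt hs
    set t := s + P with ht
    have ht1 : 0 < t - 1 := by rw [ht, hP]; linarith
    have ht0 : 0 < t := by linarith
    have e1 : k / t + ε / (t * (t - 1)) - 1 / t = (k - 1) * s / (t * (t - 1)) := by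
      have : s = t - 1 + ε / (k - 1) := by rw [ht, hP]; ring
      rw [this]
      field_simp
      ring
    have h1 := h t ((k - 1) * (t * (t - 1)) / (k * s)) (by linarith) (by
      rw [e1]
      field_simp)
    have e2 : k * (t - (k - 1) * (t * (t - 1)) / (k * s)) = s + P + ε + P * ε / s := by
      have h3 : (k - 1) * (t - 1) = (k - 1) * s - ε := by
        rw [ht, hP]
        field_simp
        ring
      have h4 : k * (t - (k - 1) * (t * (t - 1)) / (k * s))
          = k * t - t * ((k - 1) * (t - 1)) / s := by
        field_simp
      rw [h4, h3, ht]
      field_simp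
      ring
    rw [← e2]
    exact mul_le_mul_of_nonneg_left h1 hk0.le
  suffices hfin : k * x ≤ (√P + √ε) ^ 2 by
    rw [one_div, ← div_eq_inv_mul, le_div_iff₀ hk0]
    linarith
  rcases hε0.eq_or_lt with rfl | hε
  · have hP1 : P = 1 := by simp [hP]
    rw [hP1, Real.sqrt_one, Real.sqrt_zero]
    refine le_of_forall_pos_le_add fun s hs => ?_
    have := key s (by simpa using hs)
    rw [hP1] at this
    simp at this
    linarith
  · have hPpos : 0 < P := (div_pos hε (by positivity)).trans_le hPε
    set s₀ := √P * √ε with hs₀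
    have hs0 : 0 < s₀ := by positivity
    have hsq : s₀ * s₀ = P * ε := by
      rw [hs₀, mul_mul_mul_comm, Real.mul_self_sqrt hP0, Real.mul_self_sqrt hε0]
    have hge : ε / (k - 1) ≤ s₀ := by
      apply le_of_sq_le_sq _ hs0.le
      have : (ε / (k - 1)) ^ 2 = ε / (k - 1) ^ 2 * ε := by
        rw [div_pow]
        ring
      rw [this, sq s₀, hsq]
      exact mul_le_mul_of_nonneg_right hPε hε0
    have hcont : ContinuousAt (fun s => s + P + ε + P * ε / s) s₀ := by
      have := hs0.ne'
      fun_prop (disch := assumption)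
    have hlim := hcont.tendsto.mono_left (nhdsWithin_le_nhds (s := Set.Ioi s₀))
    have h1 := ge_of_tendsto hlim
      (Filter.eventually_of_mem self_mem_nhdsWithin fun s hs => key s (hge.trans_lt hs))
    have h2 : P * ε / s₀ = s₀ := by
      rw [← hsq]
      field_simp
    rw [h2] at h1
    have h3 : (√P + √ε) ^ 2 = P + ε + 2 * s₀ := by
      rw [add_sq, Real.sq_sqrt hP0, Real.sq_sqrt hε0, hs₀]
      ring
    linarith

end KMChar

theorem mainTheorem5 (k m : ℕ) (hk : 2 ≤ k) (hm : 1 ≤ m)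
    (A : Matrix (Fin (k * m)) (Fin (k * m)) ℂ)
    (hA0 : A.PosSemidef) (hA1 : (1 - A).PosSemidef)
    (ε : ℝ)
    (hε : IsGreatest
      (Set.range fun i : Fin m => ∑ j : Fin k, (A (KMChar.pos j i) (KMChar.pos j i)).re) ε)
    (hεk : ε ≤ ((k : ℝ) - 1) ^ 2 / (k : ℝ)) :
    KMChar.RealRooted (KMChar.kmCharpoly k m A) ∧
    IsGreatest (KMChar.realRoots (KMChar.kmCharpoly k m A))
      (KMChar.maxroot (KMChar.kmCharpoly k m A)) ∧
    KMChar.maxroot (KMChar.kmCharpoly k m A) ≤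
      1 / (k : ℝ) * (Real.sqrt (1 - ε / ((k : ℝ) - 1)) + Real.sqrt ε) ^ 2 := by
  open KMChar in
  set B := A.submatrix (blockEquiv k m) (blockEquiv k m) with hBdef
  have hB : B.PosSemidef := hA0.submatrix _
  have hB1 : (1 - B).PosSemidef := by
    have : 1 - B = (1 - A).submatrix (blockEquiv k m) (blockEquiv k m) := by
      ext p q
      simp [hBdef, Matrix.one_apply]
    rw [this]
    exact hA1.submatrix _
  have hcard : Fintype.card (Fin k) = k := Fintype.card_fin k
  have hF := minorSum_sliceFamily B hcard hk hB.isHermitian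
  have hadm : Admissible k (fun _ : Fin m => 1) := fun _ => Or.inr (Or.inl rfl)
  have hst := hF.stable hk fun n hn => stable_minorSum_of_unprocessed hcard hB hn
  have hkpow : (1 / (k : ℂ) ^ m) ≠ 0 := by
    have : (k : ℂ) ≠ 0 := by exact_mod_cast (by omega : k ≠ 0)
    positivity
  set p := kmCharpoly k m A with hp
  have heval : ∀ x : ℂ, p.eval x = 1 / (k : ℂ) ^ m * minorSum B (fun _ => 1) fun _ => x :=
    eval_kmCharpoly A
  have hupper : ∀ z : ℂ, 0 < z.im → p.eval z ≠ 0 := fun z hz => by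
    rw [heval]
    exact mul_ne_zero hkpow (hst _ hadm _ fun _ => hz)
  obtain ⟨R, hR⟩ := exists_real_polynomial p fun x => by
    rw [heval, hF.apply_ofReal (fun _ => 1) fun _ => x]
    have : 1 / (k : ℂ) ^ m = ((1 / (k : ℝ) ^ m : ℝ) : ℂ) := by push_cast; rfl
    rw [this, ← Complex.ofReal_mul, Complex.ofReal_im]
  have hreal : ∀ z : ℂ, p.IsRoot z → z.im = 0 := by
    intro z hz
    rcases lt_trichotomy z.im 0 with h0 | h0 | h0
    · refine absurd ?_ (hupper (starRingEnd ℂ z) (by simpa using h0))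
      rw [Polynomial.IsRoot, ← hR, Polynomial.eval_map_algebraMap] at hz
      rw [← hR, Polynomial.eval_map_algebraMap, aeval_conj_complex, hz, map_zero]
    · exact h0
    · exact absurd hz (hupper z h0)
  have hcoeff := coeff_kmCharpoly_ne_zero (m := m) (by omega : 1 ≤ k) A
  rw [← hp] at hcoeff
  have hp0 : p ≠ 0 := fun h => hcoeff (by simp [h])
  have hfin : (realRoots p).Finite := by
    refine Set.Finite.subset (s := Complex.ofReal ⁻¹' {z | z ∈ p.roots.toFinset})
      (Set.Finite.preimage Complex.ofReal_injective.injOn (Finset.finite_toSet _)) ?_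
    intro x hx
    simpa [hp0] using (show p.IsRoot x from hx)
  have hne : (realRoots p).Nonempty := by
    obtain ⟨z, hz⟩ := Complex.exists_root (f := p) (by
      rw [← Polynomial.natDegree_pos_iff_degree_pos]
      exact (by omega : 0 < m).trans_le (Polynomial.le_natDegree_of_ne_zero hcoeff))
    have e : ((z.re : ℝ) : ℂ) = z := Complex.ext rfl (by simp [hreal z hz])
    exact ⟨z.re, by rw [realRoots, Set.mem_ofPred_eq, e]; exact hz⟩
  have hmem : maxroot p ∈ realRoots p := hne.csSup_mem hfin
  refine ⟨⟨hp0, fun n => ?_, hreal⟩, ⟨hmem, fun x hx => le_csSup hfin.bddAbove hx⟩, ?_⟩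
  · rw [← hR, Polynomial.coeff_map]
    exact Complex.ofReal_im _
  obtain ⟨⟨i₀, hi₀⟩, hub⟩ := hε
  have hεB : ∀ i, ∑ s : Fin k, (B (i, s) (i, s)).re ≤ ε := fun i => hub ⟨i, rfl⟩
  have hε0 : 0 ≤ ε := by
    rw [← hi₀]
    exact Finset.sum_nonneg fun j _ => (Complex.le_def.1 hA0.diag_nonneg).1
  have hk2 : (2 : ℝ) ≤ k := by exact_mod_cast hk
  refine le_of_forall_barrier hk2 hε0 hεk fun t δ ht hδ => ?_
  have ht1 : 0 < t - 1 := by linarith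
  have hφt : 1 / t < k / t + ε / (t * (t - 1)) := by
    have h1 : 1 / t < k / t := div_lt_div_of_pos_right (by linarith) (by linarith)
    have h2 : 0 ≤ ε / (t * (t - 1)) := by positivity
    linarith
  have hbar := hF.barrier hk hφt hδ hst
    (fun n hn => barrier_minorSum_of_unprocessed hcard hk hB hB1 ht hεB rfl hn) _ hadm
  by_contra! hlt
  have hpos := hbar.pos (fun _ => maxroot p) fun i => by simpa [base] using hlt.le
  have hz : p.eval ((maxroot p : ℝ) : ℂ) = 0 := hmem
  rw [heval, hF.apply_ofReal (fun _ => 1) fun _ => maxroot p] at hz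
  refine mul_ne_zero hkpow ?_ hz
  exact_mod_cast hpos.ne'
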